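/- **Model.** Let $A\in\mathbb{R}_{\ge 0}^{n\times m}$, let $Y_1,\dots,Y_m$ be independent nonnegative random variables, and let $X=AY$, i.e. $X_i=\sum_{j}A_{ij}Y_j$. We say that $A$ has column sparsity (at most) $s_{\mathrm{col}}$ if every column of $A$ has at most $s_{\mathrm{col}}$ nonzero entries. A (possibly randomized) online algorithm with cardinality constraint $r$ is given $A$ and the distributions of $Y_1,\dots,Y_m$, observes $X_1,\dots,X_n$ one at a time (but not the $Y_j$), and, upon observing $X_i$, irrevocably accepts or rejects it, knowing only $X_1,\dots,X_i$ and its own internal randomness (independent of $Y$), subject to accepting at most $r$ values in total. If $Q$ is the set of accepted indices, then $\mathrm{ALG}=\sum_{i\in Q}X_i$, while $\mathrm{OPT}=\sum_{k=1}^{r}X^{(k)}$, where $X^{(k)}$ is the $k$-th largest of $X_1,\dots,X_n$ (and $X^{(k)}=0$ for $k>n$). The linearly correlated prophets problem with column sparsity $s_{\mathrm{col}}$ and cardinality constraint $r$ *admits an $\alpha$-approximation* if for all $n,m$, all such $A$ of column sparsity at most $s_{\mathrm{col}}$ and all distributions of $Y_1,\dots,Y_m$ there is such an algorithm with $\mathbb{E}[\mathrm{ALG}]\ge\frac1\alpha\,\mathbb{E}[\mathrm{OPT}]$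 (expectations in $[0,\infty]$). **Theorem.** There is an absolute constant $C>0$ such that for all integers $s_{\mathrm{col}}\ge 0$ and $r\ge\max\{2,s_{\mathrm{col}}\}$, the linearly correlated prophets problem with column sparsity $s_{\mathrm{col}}$ and cardinality constraint $r$ admits a $$\Big(1+C\,\big(\tfrac{s_{\mathrm{col}}}{r}\big)^{1/5}(\log r)^{6/5}\Big)\text{-approximation}.$$ In particular, for every fixed $s_{\mathrm{col}}$ the approximation ratio tends to $1$ as $r\to\infty$. -/

import Mathlib

open MeasureTheory Filter Topology
open scoped NNReal ENNReal

noncomputable section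

namespace LinProphet

/-- Column sparsity of a matrix: the maximum number of nonzero entries in a column
(`0` if there are no columns). -/
def colSparsity {n m : ℕ} (A : Matrix (Fin n) (Fin m) ℝ≥0) : ℕ :=
  Finset.univ.sup fun j : Fin m => (Finset.univ.filter fun i : Fin n => A i j ≠ 0).card

/-- `x^{(1)} + ⋯ + x^{(r)}`, where `x^{(k)}` is the `k`-th largest of `x 0, …, x (n-1)`
(all the values are summed if `n ≤ r`). -/
def opt {n : ℕ} (r : ℕ) (x : Fin n → ℝ≥0) : ℝ≥0 :=
  (((List.ofFn x).mergeSort (fun a b => decide (b ≤ a))).take r).sum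

/-- A randomized online algorithm for arrivals `x 0, …, x (n-1)` under the cardinality
constraint `r`. A seed is drawn from `seedLaw` before the first arrival; `select ω x` is the set of
arrivals that are accepted. Whether arrival `i` is accepted depends only on the seed and on the
values `x k`, `k ≤ i`, seen so far, and it is a measurable function of these. -/
structure OnlineAlgorithm (n r : ℕ) where
  Seed : Type
  seedSpace : MeasurableSpace Seed
  seedLaw : Measure Seed
  seedLaw_prob : IsProbabilityMeasure seedLaw
  select : Seed → (Fin n → ℝ≥0) → Finset (Fin n)
  select_online : ∀ (ω : Seed) (i : Fin n) (x x' : Fin n → ℝ≥0),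
    (∀ k, k ≤ i → x k = x' k) → (i ∈ select ω x ↔ i ∈ select ω x')
  select_measurable : ∀ i : Fin n,
    MeasurableSet {p : Seed × (Fin n → ℝ≥0) | i ∈ select p.1 p.2}
  select_card : ∀ (ω : Seed) (x : Fin n → ℝ≥0), (select ω x).card ≤ r

attribute [instance] OnlineAlgorithm.seedSpace OnlineAlgorithm.seedLaw_prob

/-- The expected reward `𝔼[ALG]` of an algorithm on the arrivals `X = A Y`, where the `Y j` are
independent with laws `μ j`, and the seed is independent of `Y`. -/
def expectedReward {n m r : ℕ} (alg : OnlineAlgorithm n r) (A : Matrix (Fin n) (Fin m) ℝ≥0)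
    (μ : Fin m → Measure ℝ≥0) : ℝ≥0∞ :=
  ∫⁻ ω, ∫⁻ y, ((∑ i ∈ alg.select ω (A.mulVec y), A.mulVec y i : ℝ≥0) : ℝ≥0∞)
    ∂(Measure.pi μ) ∂alg.seedLaw

/-- The prophet's expected reward `𝔼[OPT]`, where `OPT` is the sum of the `r` largest entries
of `X = A Y` and the `Y j` are independent with laws `μ j`. -/
def expectedOpt {n m : ℕ} (r : ℕ) (A : Matrix (Fin n) (Fin m) ℝ≥0)
    (μ : Fin m → Measure ℝ≥0) : ℝ≥0∞ :=
  ∫⁻ y, (opt r (A.mulVec y) : ℝ≥0∞) ∂(Measure.pi μ)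

/-- The linearly correlated prophets problem with column sparsity `s` and cardinality
constraint `r` admits an `α`-approximation: for every number of arrivals and of features, every
nonnegative matrix with at most `s` nonzero entries per column and all laws of the features, there
is an online algorithm (which may depend on the matrix and on the laws) with
`𝔼[ALG] ≥ (1 / α) 𝔼[OPT]`. -/
def AdmitsApproximation (s r : ℕ) (α : ℝ) : Prop :=
  ∀ (n m : ℕ) (A : Matrix (Fin n) (Fin m) ℝ≥0) (μ : Fin m → Measure ℝ≥0),
    (∀ j, IsProbabilityMeasure (μ j)) → colSparsity A ≤ s →
      ∃ alg : OnlineAlgorithm n r,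
        ENNReal.ofReal (1 / α) * expectedOpt r A μ ≤ expectedReward alg A μ

/-- The ratio `1 + C (s / r)^{1/5} (log r)^{6/5}`. -/
def approxRatio (C : ℝ) (s r : ℕ) : ℝ :=
  1 + C * (((s : ℝ) / (r : ℝ)) ^ (1 / 5 : ℝ) * (Real.log r) ^ (6 / 5 : ℝ))

end LinProphet

end

noncomputable section

namespace LinProphet

/-! ### Integrals over a finite product -/

/-! For every threshold `τ`, the prophet gets at most `r τ + ∑ 𝔼 (X i - τ)⁺` (`benchmark`). Call an
arrival a candidate if it passes `τ`, with some ties at `τ` admitted. If the expected number of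
candidates is nearly `r`, their expected total value is nearly the benchmark, so it remains to show
that accepting the first `r` candidates loses little. Each feature influences at most `s` candidate
indicators, so their number has variance at most `s` times its mean (`variance_sum_le`). With `u =
(s/r)^{1/5}` and mean about `(1 - 2u) r`, Chebyshev bounds the probability of more than `r - s`
candidates by `u`.

The difficulty is that overflow may be correlated with large values. The value of a candidate is
therefore split into `share`s and a `rest`. A contribution `A i j * Y j` exceeding `τ` alone makes
`i` a candidate, hence depends on `Y j` only and is independent of the number of candidates not
depending on `Y j`. If there are at most `r - s` of those, `i` is accepted, since fewer than `s`
other arrivals depend on `Y j`. The same independence handles all contributions to arrivals that are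
candidates with probability at least `1/4`: bounding a share by `A i j * Y j` costs only `τ` on the
event of not being a candidate. See `le_sum_integral_share_mul_slack`.

The rest consists of sums of contributions of size at most `τ`, for arrivals with candidate
probability `p ≤ 1/4`. A restart argument (`integral_excess_sq_le`) shows that such a sum,
restricted to the candidate event, has second moment `O(τ² p)`. The total rest thus again has small
variance, and little of it sits on the overflow event (`integral_rest_overflow_le`). Altogether a
fraction `1 - 29u` of the benchmark is collected (`benchmark_le_of_sparse`).

If `u` is not small, a constant factor suffices (`exists_benchmark_le`). Here `s` may equal `r`, so
the arrivals sharing a feature could fill all slots; considering only a uniformly random set of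
arrivals halves their number, and averaging yields one good deterministic set.

The logarithmic factor of the ratio enters only through a positive lower bound for `r ≥ 2`. -/

lemma integrable_of_abs_le {Ω : Type*} [MeasurableSpace Ω] {P : Measure Ω} [IsFiniteMeasure P]
    {f : Ω → ℝ} {B : ℝ} (hf : Measurable f) (hB : ∀ y, |f y| ≤ B) : Integrable f P :=
  Integrable.of_bound hf.aestronglyMeasurable B (Eventually.of_forall hB)

lemma measurable_insertNth {α : Type*} [MeasurableSpace α] {m : ℕ} (j : Fin (m + 1)) :
    Measurable fun p : α × (Fin m → α) => (j.insertNth p.1 p.2 : Fin (m + 1) → α) := by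
  have h := (MeasurableEquiv.piFinSuccAbove (fun _ : Fin (m + 1) => α) j).symm.measurable
  exact h

lemma integral_pi_eq_insertNth {α : Type*} [MeasurableSpace α] {m : ℕ}
    (μ : Fin (m + 1) → Measure α) [∀ j, IsProbabilityMeasure (μ j)] (j : Fin (m + 1))
    (f : (Fin (m + 1) → α) → ℝ) :
    ∫ y, f y ∂(Measure.pi μ) = ∫ p : α × (Fin m → α), f (j.insertNth p.1 p.2)
      ∂((μ j).prod (Measure.pi fun k => μ (j.succAbove k))) := by
  have h := (measurePreserving_piFinSuccAbove μ j).symm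
  rw [← h.integral_comp (MeasurableEquiv.measurableEmbedding _)]
  rfl

/-- Integrating over one coordinate and then over the others. -/
lemma integral_pi_eq_iterated {α : Type*} [MeasurableSpace α] {m : ℕ}
    (μ : Fin (m + 1) → Measure α) [∀ j, IsProbabilityMeasure (μ j)] (j : Fin (m + 1))
    {f : (Fin (m + 1) → α) → ℝ} {B : ℝ} (hf : Measurable f) (hB : ∀ y, |f y| ≤ B) :
    ∫ y, f y ∂(Measure.pi μ) = ∫ t, ∫ w, f (j.insertNth t w)
      ∂(Measure.pi fun k => μ (j.succAbove k)) ∂(μ j) := by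
  rw [integral_pi_eq_insertNth μ j, integral_prod]
  exact integrable_of_abs_le (hf.comp (measurable_insertNth j)) fun _ => hB _

lemma measurable_integral_insertNth {α : Type*} [MeasurableSpace α] {m : ℕ}
    (ν : Measure (Fin m → α)) [IsProbabilityMeasure ν] (j : Fin (m + 1))
    {f : (Fin (m + 1) → α) → ℝ} (hf : Measurable f) :
    Measurable fun t => ∫ w, f (j.insertNth t w) ∂ν := by
  have h : StronglyMeasurable fun p : α × (Fin m → α) => f (j.insertNth p.1 p.2) :=
    (hf.comp (measurable_insertNth j)).stronglyMeasurable
  exact h.integral_prod_right'.measurable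

lemma abs_integral_le_of_abs_le {Ω : Type*} [MeasurableSpace Ω] {P : Measure Ω}
    [IsProbabilityMeasure P] {f : Ω → ℝ} {B : ℝ} (hB : ∀ y, |f y| ≤ B) : |∫ y, f y ∂P| ≤ B := by
  have h := norm_integral_le_of_norm_le_const (μ := P) (f := f) (C := B) (Eventually.of_forall hB)
  simpa using h

/-- A function of one coordinate is independent of a function of the other coordinates. -/
lemma integral_coord_mul {α : Type*} [MeasurableSpace α] {m : ℕ}
    (μ : Fin m → Measure α) [∀ j, IsProbabilityMeasure (μ j)] (j : Fin m) (φ : α → ℝ)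
    (ψ : (Fin m → α) → ℝ) (hψ : DependsOn ψ {j}ᶜ) :
    ∫ y, φ (y j) * ψ y ∂(Measure.pi μ)
      = (∫ y, φ (y j) ∂(Measure.pi μ)) * ∫ y, ψ y ∂(Measure.pi μ) := by
  obtain _ | m := m
  · exact j.elim0
  obtain ⟨t₀⟩ : Nonempty α := (μ j).nonempty_of_neZero
  have key : ∀ t w, ψ (j.insertNth t w) = ψ (j.insertNth t₀ w) := by
    intro t w
    refine hψ fun k hk => ?_
    obtain ⟨k, rfl⟩ := Fin.exists_succAbove_eq (show k ≠ j from hk)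
    simp
  rw [integral_pi_eq_insertNth μ j, integral_pi_eq_insertNth μ j,
    integral_pi_eq_insertNth μ j]
  simp only [Fin.insertNth_apply_same]
  have h1 : ∀ p : α × (Fin m → α), φ p.1 * ψ (j.insertNth p.1 p.2)
      = φ p.1 * ψ (j.insertNth t₀ p.2) := fun p => by rw [key]
  have h2 : ∀ p : α × (Fin m → α), ψ (j.insertNth p.1 p.2)
      = ψ (j.insertNth t₀ p.2) := fun p => by rw [key]
  simp only [h2]
  rw [integral_prod_mul φ fun w => ψ (j.insertNth t₀ w),
    integral_fun_fst, integral_fun_snd (μ := μ j) (fun w => ψ (j.insertNth t₀ w))]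
  simp

/-! ### The variance of a sum of sparsely dependent functions -/

lemma integral_sub_mean_sq {Ω : Type*} [MeasurableSpace Ω] {P : Measure Ω}
    [IsProbabilityMeasure P] {f : Ω → ℝ} {B : ℝ} (hf : Measurable f) (hB : ∀ y, |f y| ≤ B) :
    ∫ y, (f y - ∫ z, f z ∂P) ^ 2 ∂P = ∫ y, f y ^ 2 ∂P - (∫ y, f y ∂P) ^ 2 := by
  have hi : Integrable f P := integrable_of_abs_le hf hB
  have hi2 : Integrable (fun y => f y ^ 2) P :=
    integrable_of_abs_le (B := B ^ 2) (hf.pow_const 2) fun y => by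
      rw [abs_pow]; exact pow_le_pow_left₀ (abs_nonneg _) (hB y) 2
  set c := ∫ z, f z ∂P
  have : ∀ y, (f y - c) ^ 2 = f y ^ 2 - 2 * c * f y + c ^ 2 := fun y => by ring
  simp only [this]
  rw [integral_add (by fun_prop) (by fun_prop), integral_sub (by fun_prop) (by fun_prop),
    integral_const_mul]
  simp only [integral_const, probReal_univ, smul_eq_mul]
  change _ - 2 * c * c + _ = _
  ring

/-- Only the summands in `J` contribute to the centred sum, so this is Cauchy–Schwarz over at most
`s` terms. It is the one-coordinate case of `variance_sum_le`. -/
lemma variance_sum_le_of_const {Ω ι : Type*} [MeasurableSpace Ω] [Fintype ι] {P : Measure Ω}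
    [IsProbabilityMeasure P] (s : ℕ) (J : Finset ι) (hJ : J.card ≤ s) (g : ι → Ω → ℝ) (B : ℝ)
    (hg : ∀ i, Measurable (g i)) (hB : ∀ i y, |g i y| ≤ B)
    (hc : ∀ i, i ∉ J → ∀ y y', g i y = g i y') :
    ∫ y, (∑ i, g i y) ^ 2 ∂P - (∫ y, ∑ i, g i y ∂P) ^ 2
      ≤ s * ∑ i, (∫ y, g i y ^ 2 ∂P - (∫ y, g i y ∂P) ^ 2) := by
  have hi : ∀ i, Integrable (g i) P := fun i => integrable_of_abs_le (hg i) (hB i)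
  have hsum : ∀ y, |∑ i, g i y| ≤ ∑ _i : ι, B := fun y =>
    (Finset.abs_sum_le_sum_abs _ _).trans (Finset.sum_le_sum fun i _ => hB i y)
  have hd2 : ∀ i, Integrable (fun y => (g i y - ∫ z, g i z ∂P) ^ 2) P := fun i =>
    integrable_of_abs_le (B := (B + B) ^ 2) (((hg i).sub_const _).pow_const 2) fun y => by
      rw [abs_pow]
      refine pow_le_pow_left₀ (abs_nonneg _) ((abs_sub _ _).trans ?_) 2
      exact add_le_add (hB i y) (abs_integral_le_of_abs_le (hB i))
  rw [← integral_sub_mean_sq (Finset.measurable_sum _ fun i _ => hg i) hsum]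
  simp only [← fun i => integral_sub_mean_sq (P := P) (hg i) (hB i)]
  rw [← integral_finsetSum _ fun i _ => hd2 i, ← integral_const_mul]
  refine integral_mono_of_nonneg (Eventually.of_forall fun y => sq_nonneg _)
    ((integrable_finsetSum _ fun i _ => hd2 i).const_mul _) (Eventually.of_forall fun y => ?_)
  have h0 : ∀ i, i ∉ J → g i y - ∫ z, g i z ∂P = 0 := fun i hiJ => by
    have : ∀ z, g i z = g i y := fun z => hc i hiJ z y
    simp [this]
  have h1 : ∑ i, g i y - ∫ z, ∑ i, g i z ∂P = ∑ i ∈ J, (g i y - ∫ z, g i z ∂P) := by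
    rw [integral_finsetSum _ fun i _ => hi i, ← Finset.sum_sub_distrib]
    exact (Finset.sum_subset (Finset.subset_univ J) fun i _ h => h0 i h).symm
  change (∑ i, g i y - ∫ z, ∑ i, g i z ∂P) ^ 2 ≤ _
  rw [h1]
  refine sq_sum_le_card_mul_sum_sq.trans ?_
  refine mul_le_mul (by exact_mod_cast hJ) ?_ (Finset.sum_nonneg fun i _ => sq_nonneg _)
    (Nat.cast_nonneg _)
  exact Finset.sum_le_sum_of_subset_of_nonneg (Finset.subset_univ _) fun i _ _ => sq_nonneg _

/-- If every coordinate influences at most `s` of the functions `f i`, then the variance of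
`∑ i, f i` is at most `s` times the sum of the variances. -/
theorem variance_sum_le {α ι : Type*} [MeasurableSpace α] [Fintype ι] (s : ℕ) {m : ℕ}
    (μ : Fin m → Measure α) [∀ j, IsProbabilityMeasure (μ j)] (S : ι → Finset (Fin m))
    (f : ι → (Fin m → α) → ℝ) (B : ℝ) (hf : ∀ i, Measurable (f i)) (hB : ∀ i y, |f i y| ≤ B)
    (hS : ∀ i, DependsOn (f i) (S i)) (hs : ∀ j, (Finset.univ.filter fun i => j ∈ S i).card ≤ s) :
    ∫ y, (∑ i, f i y) ^ 2 ∂(Measure.pi μ) - (∫ y, ∑ i, f i y ∂(Measure.pi μ)) ^ 2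
      ≤ s * ∑ i, (∫ y, f i y ^ 2 ∂(Measure.pi μ) - (∫ y, f i y ∂(Measure.pi μ)) ^ 2) := by
  induction m with
  | zero =>
    refine variance_sum_le_of_const s ∅ (by simp) f B hf hB fun i _ y y' => ?_
    rw [Subsingleton.elim y y']
  | succ m ih =>
    set ν : Measure (Fin m → α) := Measure.pi fun k => μ ((0 : Fin (m + 1)).succAbove k) with hν
    have hsum : ∀ y, |∑ i, f i y| ≤ ∑ _i : ι, B := fun y =>
      (Finset.abs_sum_le_sum_abs _ _).trans (Finset.sum_le_sum fun i _ => hB i y)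
    have hfs : Measurable fun y => ∑ i, f i y := Finset.measurable_sum _ fun i _ => hf i
    have sqb : ∀ {x C : ℝ}, |x| ≤ C → |x ^ 2| ≤ C ^ 2 := fun {x C} h => by
      rw [abs_pow]; exact pow_le_pow_left₀ (abs_nonneg _) h 2
    set g : ι → α → ℝ := fun i t => ∫ w, f i ((0 : Fin (m + 1)).insertNth t w) ∂ν with hg
    have hgm : ∀ i, Measurable (g i) := fun i => measurable_integral_insertNth ν 0 (hf i)
    have hgB : ∀ i t, |g i t| ≤ B := fun i t => abs_integral_le_of_abs_le fun w => hB i _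
    have hgsB : ∀ t, |∑ i, g i t| ≤ ∑ _i : ι, B := fun y =>
      (Finset.abs_sum_le_sum_abs _ _).trans (Finset.sum_le_sum fun i _ => hgB i y)
    have hgs : Measurable fun t => ∑ i, g i t := Finset.measurable_sum _ fun i _ => hgm i
    have hins : ∀ t, Measurable fun w : Fin m → α => ((0 : Fin (m + 1)).insertNth t w :
        Fin (m + 1) → α) := fun t =>
      (measurable_insertNth (α := α) (0 : Fin (m + 1))).comp (measurable_const.prodMk measurable_id)
    have hfi : ∀ i t, Integrable (fun w => f i ((0 : Fin (m + 1)).insertNth t w)) ν := fun i t =>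
      integrable_of_abs_le ((hf i).comp (hins t)) fun w => hB i _
    -- Law of total variance with respect to the first coordinate: `h1` bounds the conditional
    -- variance given that coordinate by induction, `h2` bounds the variance of the conditional
    -- means `g`, of which at most `s` are nonconstant. Both bounds carry the same factor `s`, so
    -- they add up.
    have h1 : ∀ t, ∫ w, (∑ i, f i ((0 : Fin (m + 1)).insertNth t w)) ^ 2 ∂ν - (∑ i, g i t) ^ 2
        ≤ s * ∑ i, (∫ w, f i ((0 : Fin (m + 1)).insertNth t w) ^ 2 ∂ν - g i t ^ 2) := by
      intro t
      have := ih (fun k => μ ((0 : Fin (m + 1)).succAbove k))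
        (fun i => Finset.univ.filter fun k => (0 : Fin (m + 1)).succAbove k ∈ S i)
        (fun i w => f i ((0 : Fin (m + 1)).insertNth t w))
        (fun i => (hf i).comp (hins t)) (fun i w => hB i _) ?_ ?_
      · rwa [integral_finsetSum _ fun i _ => hfi i t] at this
      · intro i w w' hw
        refine hS i fun k hk => ?_
        refine Fin.cases ?_ (fun k hk => ?_) k hk
        · intro _; simp
        · have := hw k (Finset.mem_coe.2 (Finset.mem_filter.2 ⟨Finset.mem_univ _, hk⟩))
          simpa using this
      · intro k
        refine (Finset.card_le_card fun i hi => ?_).trans (hs k.succ)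
        exact Finset.mem_filter.2
          ⟨Finset.mem_univ _, (Finset.mem_filter.1 (Finset.mem_filter.1 hi).2).2⟩
    have h2 : ∫ t, (∑ i, g i t) ^ 2 ∂(μ 0) - (∫ t, ∑ i, g i t ∂(μ 0)) ^ 2
        ≤ s * ∑ i, (∫ t, g i t ^ 2 ∂(μ 0) - (∫ t, g i t ∂(μ 0)) ^ 2) := by
      refine variance_sum_le_of_const s (Finset.univ.filter fun i => 0 ∈ S i) (hs 0) g B hgm hgB ?_
      intro i hi t t'
      refine integral_congr_ae (Eventually.of_forall fun w => hS i fun k hk => ?_)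
      refine Fin.cases (fun h0 => ?_) (fun k _ => by simp) k hk
      simp at hi; exact absurd h0 hi
    have e1 : ∫ y, (∑ i, f i y) ^ 2 ∂(Measure.pi μ)
        = ∫ t, ∫ w, (∑ i, f i ((0 : Fin (m + 1)).insertNth t w)) ^ 2 ∂ν ∂(μ 0) :=
      integral_pi_eq_iterated μ 0 (hfs.pow_const 2) fun y => sqb (hsum y)
    have e2 : ∫ y, (∑ i, f i y) ∂(Measure.pi μ) = ∫ t, ∑ i, g i t ∂(μ 0) := by
      rw [integral_pi_eq_iterated μ 0 hfs hsum]
      exact integral_congr_ae (Eventually.of_forall fun t => integral_finsetSum _ fun i _ => hfi i t)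
    have e3 : ∀ i, ∫ y, f i y ^ 2 ∂(Measure.pi μ)
        = ∫ t, ∫ w, f i ((0 : Fin (m + 1)).insertNth t w) ^ 2 ∂ν ∂(μ 0) := fun i =>
      integral_pi_eq_iterated μ 0 ((hf i).pow_const 2) fun y => sqb (hB i y)
    have e4 : ∀ i, ∫ y, f i y ∂(Measure.pi μ) = ∫ t, g i t ∂(μ 0) := fun i =>
      integral_pi_eq_iterated μ 0 (hf i) (hB i)
    have i1 : Integrable (fun t => ∫ w, (∑ i, f i ((0 : Fin (m + 1)).insertNth t w)) ^ 2 ∂ν) (μ 0) :=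
      integrable_of_abs_le (measurable_integral_insertNth ν 0 (hfs.pow_const 2))
        fun t => abs_integral_le_of_abs_le fun w => sqb (hsum _)
    have i2 : Integrable (fun t => (∑ i, g i t) ^ 2) (μ 0) :=
      integrable_of_abs_le (hgs.pow_const 2) fun t => sqb (hgsB t)
    have i3 : ∀ i, Integrable (fun t => ∫ w, f i ((0 : Fin (m + 1)).insertNth t w) ^ 2 ∂ν) (μ 0) :=
      fun i => integrable_of_abs_le (measurable_integral_insertNth ν 0 ((hf i).pow_const 2))
        fun t => abs_integral_le_of_abs_le fun w => sqb (hB i _)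
    have i4 : ∀ i, Integrable (fun t => g i t ^ 2) (μ 0) := fun i =>
      integrable_of_abs_le ((hgm i).pow_const 2) fun t => sqb (hgB i t)
    have h3 := integral_mono (i1.sub i2)
      ((integrable_finsetSum Finset.univ fun i _ => (i3 i).sub (i4 i)).const_mul (s : ℝ)) h1
    rw [integral_sub' i1 i2, integral_const_mul,
      integral_finsetSum _ fun i _ => (i3 i).sub (i4 i)] at h3
    simp only [fun i => integral_sub' (i3 i) (i4 i)] at h3
    rw [e1, e2]
    simp only [e3, e4]
    simp only [Finset.sum_sub_distrib, mul_sub] at h2 h3 ⊢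
    linarith

/-! ### Restarting a sum of bounded nonnegative terms -/

/-- A sum of independent variables with values in `[0, τ]` that exceeds `c + τ` by some amount has
to pass `c`, and then to collect that amount once more. -/
theorem integral_excess_sq_le {α : Type*} [MeasurableSpace α] {m : ℕ}
    (μ : Fin m → Measure α) [∀ j, IsProbabilityMeasure (μ j)] (τ : ℝ) (hτ : 0 ≤ τ)
    (z : Fin m → α → ℝ) (hz : ∀ j, Measurable (z j)) (hz0 : ∀ j t, 0 ≤ z j t)
    (hzτ : ∀ j t, z j t ≤ τ) (c : ℝ) (hc : 0 ≤ c) :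
    ∫ y, (max (∑ j, z j (y j) - c - τ) 0) ^ 2 ∂(Measure.pi μ)
      ≤ (∫ y, (Set.Ioi c).indicator 1 (∑ j, z j (y j)) ∂(Measure.pi μ))
        * ∫ y, (∑ j, z j (y j)) ^ 2 ∂(Measure.pi μ) := by
  induction m generalizing c with
  | zero =>
    have : max (-c - τ) 0 = 0 := max_eq_right (by linarith)
    simp [this]
  | succ m ih =>
    set ν : Measure (Fin m → α) := Measure.pi fun k => μ ((0 : Fin (m + 1)).succAbove k) with hν
    set Z : (Fin m → α) → ℝ := fun w => ∑ k, z k.succ (w k) with hZ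
    have hZm : Measurable Z :=
      Finset.measurable_sum _ fun k _ => (hz _).comp (measurable_pi_apply k)
    have hZ0 : ∀ w, 0 ≤ Z w := fun w => Finset.sum_nonneg fun k _ => hz0 _ _
    have hZb : ∀ w, Z w ≤ m * τ := fun w => by
      have := Finset.sum_le_card_nsmul Finset.univ (fun k : Fin m => z k.succ (w k)) τ
        fun k _ => hzτ _ _
      simpa using this
    have hT : Measurable fun y : Fin (m + 1) → α => ∑ j, z j (y j) :=
      Finset.measurable_sum _ fun k _ => (hz _).comp (measurable_pi_apply k)
    have hT0 : ∀ y : Fin (m + 1) → α, 0 ≤ ∑ j, z j (y j) := fun w =>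
      Finset.sum_nonneg fun k _ => hz0 _ _
    have hTb : ∀ y : Fin (m + 1) → α, ∑ j, z j (y j) ≤ (m + 1) * τ := fun w => by
      have := Finset.sum_le_card_nsmul Finset.univ (fun k : Fin (m + 1) => z k (w k)) τ
        fun k _ => hzτ _ _
      simpa using this
    have hsplit : ∀ (t : α) (w : Fin m → α),
        ∑ j, z j ((0 : Fin (m + 1)).insertNth (α := fun _ => α) t w j) = z 0 t + Z w := by
      intro t w; rw [Fin.sum_univ_succ]; simp [hZ]
    have hm1 : Measurable fun y : Fin (m + 1) → α => (max (∑ j, z j (y j) - c - τ) 0) ^ 2 := by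
      fun_prop
    have hb1 : ∀ y : Fin (m + 1) → α, |(max (∑ j, z j (y j) - c - τ) 0) ^ 2|
        ≤ ((m + 1) * τ) ^ 2 := fun y => by
      rw [abs_pow, abs_of_nonneg (le_max_right _ _)]
      refine pow_le_pow_left₀ (le_max_right _ _) (max_le ?_ (by positivity)) 2
      linarith [hTb y]
    have hm2 : Measurable fun y : Fin (m + 1) → α =>
        (Set.Ioi c).indicator (1 : ℝ → ℝ) (∑ j, z j (y j)) :=
      (measurable_one.indicator measurableSet_Ioi).comp hT
    have hb2 : ∀ (d x : ℝ), |(Set.Ioi d).indicator (1 : ℝ → ℝ) x| ≤ 1 := fun d x => by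
      by_cases h : x ∈ Set.Ioi d <;> simp [h]
    -- Dropping a nonnegative summand lowers the second moment, so the second-moment factor can stay
    -- that of the full sum throughout the induction.
    have hM : ∫ w, Z w ^ 2 ∂ν ≤ ∫ y, (∑ j, z j (y j)) ^ 2 ∂(Measure.pi μ) := by
      rw [integral_pi_eq_iterated μ 0 (B := ((m + 1) * τ) ^ 2) (hT.pow_const 2) fun y => by
        rw [abs_pow, abs_of_nonneg (hT0 y)]; exact pow_le_pow_left₀ (hT0 y) (hTb y) 2]
      have : ∀ t, ∫ w, Z w ^ 2 ∂ν ≤ ∫ w, (∑ j, z j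
          ((0 : Fin (m + 1)).insertNth (α := fun _ => α) t w j)) ^ 2 ∂ν := fun t => by
        simp only [hsplit]
        refine integral_mono (integrable_of_abs_le (B := (m * τ) ^ 2) (hZm.pow_const 2) fun w => ?_)
          (integrable_of_abs_le (B := (τ + m * τ) ^ 2) ((hZm.const_add _).pow_const 2)
            fun w => ?_) fun w => ?_
        · rw [abs_pow, abs_of_nonneg (hZ0 w)]; exact pow_le_pow_left₀ (hZ0 w) (hZb w) 2
        · have : 0 ≤ z 0 t + Z w := add_nonneg (hz0 _ _) (hZ0 _)
          rw [abs_pow, abs_of_nonneg this]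
          exact pow_le_pow_left₀ this (add_le_add (hzτ _ _) (hZb w)) 2
        · exact pow_le_pow_left₀ (hZ0 w) (by linarith [hz0 0 t]) 2
      calc ∫ w, Z w ^ 2 ∂ν = ∫ _t, ∫ w, Z w ^ 2 ∂ν ∂(μ 0) := by simp
        _ ≤ _ := integral_mono (integrable_const _)
          (integrable_of_abs_le (B := ((m + 1) * τ) ^ 2)
            (measurable_integral_insertNth ν 0 (hT.pow_const 2))
            fun t => abs_integral_le_of_abs_le fun w => by
              rw [abs_pow, abs_of_nonneg (hT0 _)]
              exact pow_le_pow_left₀ (hT0 _) (hTb _) 2) this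
    have hI0 : ∀ (d x : ℝ), 0 ≤ (Set.Ioi d).indicator (1 : ℝ → ℝ) x := fun d x =>
      Set.indicator_nonneg (fun _ _ => zero_le_one) _
    refine le_trans ?_ (mul_le_mul_of_nonneg_left hM (integral_nonneg fun y => hI0 _ _))
    rw [integral_pi_eq_iterated μ 0 hm1 hb1, integral_pi_eq_iterated μ 0 hm2 fun y => hb2 _ _,
      ← integral_mul_const]
    refine integral_mono
      (integrable_of_abs_le (measurable_integral_insertNth ν 0 hm1)
        fun t => abs_integral_le_of_abs_le fun w => hb1 _)
      ((integrable_of_abs_le (measurable_integral_insertNth ν 0 hm2)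
        fun t => abs_integral_le_of_abs_le fun w => hb2 _ _).mul_const _) fun t => ?_
    simp only [hsplit]
    -- If the first term does not pass `c`, induct with the remaining level `c - z 0 t`. If it does,
    -- the indicator is identically one, and since the first term is at most `τ`, the excess over `c
    -- + τ` is at most the sum of the remaining terms.
    by_cases ht : z 0 t ≤ c
    · have h := ih (fun k => μ ((0 : Fin (m + 1)).succAbove k)) (fun k => z k.succ)
        (fun k => hz _) (fun k => hz0 _) (fun k => hzτ _) (c - z 0 t) (by linarith)
      have r1 : ∀ w, z 0 t + Z w - c - τ = Z w - (c - z 0 t) - τ := fun w => by ring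
      have r2 : ∀ w, (Set.Ioi c).indicator (1 : ℝ → ℝ) (z 0 t + Z w)
          = (Set.Ioi (c - z 0 t)).indicator 1 (Z w) := fun w => by
        simp only [Set.indicator, Set.mem_Ioi, sub_lt_iff_lt_add', Pi.one_apply]
      simp only [r1, r2]
      exact h
    · have h1 : ∀ w, (Set.Ioi c).indicator (1 : ℝ → ℝ) (z 0 t + Z w) = 1 := fun w => by
        have : c < z 0 t + Z w := by linarith [hZ0 w, not_le.1 ht]
        simp [this]
      simp only [h1, integral_const, probReal_univ, smul_eq_mul, mul_one, one_mul]
      refine integral_mono_of_nonneg (Eventually.of_forall fun w => sq_nonneg _)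
        (integrable_of_abs_le (B := (m * τ) ^ 2) (hZm.pow_const 2) fun w => ?_)
        (Eventually.of_forall fun w => ?_)
      · rw [abs_pow, abs_of_nonneg (hZ0 w)]; exact pow_le_pow_left₀ (hZ0 w) (hZb w) 2
      · refine pow_le_pow_left₀ (le_max_right _ _) (max_le ?_ (hZ0 w)) 2
        linarith [hzτ 0 t]

/-! ### The prophet -/

/-- Each of the `r` terms satisfies `x ≤ τ + (x - τ)⁺`. The list need not be sorted. -/
lemma sum_take_le_threshold (τ : ℝ≥0) (l : List ℝ≥0) (r : ℕ) :
    (l.take r).sum ≤ r * τ + (l.map fun x => x - τ).sum := by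
  induction l generalizing r with
  | nil => simp
  | cons x l ih =>
    cases r with
    | zero => simp
    | succ r =>
      rw [List.take_succ_cons, List.sum_cons, List.map_cons, List.sum_cons]
      calc x + (l.take r).sum ≤ (τ + (x - τ)) + (r * τ + (l.map fun x => x - τ).sum) :=
            add_le_add le_add_tsub (ih r)
        _ = _ := by push_cast; ring

lemma opt_le_threshold {n : ℕ} (r : ℕ) (τ : ℝ≥0) (x : Fin n → ℝ≥0) :
    opt r x ≤ r * τ + ∑ i, (x i - τ) := by
  refine (sum_take_le_threshold τ _ r).trans (le_of_eq ?_)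
  congr 1
  rw [((List.mergeSort_perm (List.ofFn x) _).map _).sum_eq, List.map_ofFn, List.sum_ofFn]
  rfl

/-! ### Greedy online algorithms -/

open Classical in
/-- The arrivals in `I` whose value lies in the acceptance region. -/
def candidates {n : ℕ} (I : Finset (Fin n)) (acc : Fin n → Set ℝ≥0) (x : Fin n → ℝ≥0) :
    Finset (Fin n) :=
  I.filter fun i => x i ∈ acc i

/-- The first `r` candidates. -/
def greedySelect {n : ℕ} (r : ℕ) (I : Finset (Fin n)) (acc : Fin n → Set ℝ≥0)
    (x : Fin n → ℝ≥0) : Finset (Fin n) :=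
  (candidates I acc x).filter fun i => ((candidates I acc x).filter (· < i)).card < r

lemma mem_candidates {n : ℕ} {I : Finset (Fin n)} {acc : Fin n → Set ℝ≥0} {x : Fin n → ℝ≥0}
    {i : Fin n} : i ∈ candidates I acc x ↔ i ∈ I ∧ x i ∈ acc i := by
  simp [candidates]

/-- The number of earlier candidates is strictly increasing along candidates, hence injects the
selected ones into `range r`. -/
lemma card_greedySelect_le {n : ℕ} (r : ℕ) (I : Finset (Fin n)) (acc : Fin n → Set ℝ≥0)
    (x : Fin n → ℝ≥0) : (greedySelect r I acc x).card ≤ r := by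
  set K := candidates I acc x with hK
  have hlt : ∀ i ∈ K, ∀ k, i < k → (K.filter (· < i)).card < (K.filter (· < k)).card := by
    intro i hi k hik
    refine Finset.card_lt_card (Finset.ssubset_iff.2 ⟨i, by simp, ?_⟩)
    intro l hl
    rcases Finset.mem_insert.1 hl with rfl | hl
    · exact Finset.mem_filter.2 ⟨hi, hik⟩
    · exact Finset.mem_filter.2 ⟨(Finset.mem_filter.1 hl).1, (Finset.mem_filter.1 hl).2.trans hik⟩
  have h := Finset.card_le_card_of_injOn (s := greedySelect r I acc x) (t := Finset.range r)
    (fun i => (K.filter (· < i)).card)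
    (fun i hi => Finset.mem_coe.2 (Finset.mem_range.2 (Finset.mem_filter.1 hi).2)) ?_
  · simpa using h
  · intro i hi k hk hik
    rcases lt_trichotomy i k with h | h | h
    · exact absurd hik (hlt i (Finset.mem_filter.1 hi).1 k h).ne
    · exact h
    · exact absurd hik (hlt k (Finset.mem_filter.1 hk).1 i h).ne'

/-- The first rejected candidate, if there is one, has at least `r` earlier candidates, all of them
selected. -/
lemma min_card_candidates_le {n : ℕ} (r : ℕ) (I : Finset (Fin n)) (acc : Fin n → Set ℝ≥0)
    (x : Fin n → ℝ≥0) :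
    min (candidates I acc x).card r ≤ (greedySelect r I acc x).card := by
  by_cases hall : candidates I acc x ⊆ greedySelect r I acc x
  · exact (min_le_left _ _).trans (Finset.card_le_card hall)
  · have hne : (candidates I acc x \ greedySelect r I acc x).Nonempty := by
      rwa [Finset.sdiff_nonempty]
    obtain ⟨i, hi, hmin⟩ := Finset.exists_min_image _ id hne
    obtain ⟨hiK, hiS⟩ := Finset.mem_sdiff.1 hi
    have hr : r ≤ ((candidates I acc x).filter (· < i)).card := by
      by_contra hcon
      exact hiS (Finset.mem_filter.2 ⟨hiK, not_le.1 hcon⟩)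
    refine (min_le_right _ _).trans (hr.trans (Finset.card_le_card fun k hk => ?_))
    obtain ⟨hkK, hki⟩ := Finset.mem_filter.1 hk
    by_contra hkS
    exact absurd (hmin k (Finset.mem_sdiff.2 ⟨hkK, hkS⟩)) (not_le.2 hki)

/-- For use with `K` the arrivals independent of a feature, where candidates are counted, and `B`
the others that share the feature with `i`, where every arrival of `I` is pessimistically counted as
a candidate. -/
lemma mem_greedySelect_of_card_lt {n r : ℕ} {I : Finset (Fin n)} {acc : Fin n → Set ℝ≥0}
    {x : Fin n → ℝ≥0} {i : Fin n} (hi : i ∈ I) (hx : x i ∈ acc i) (K B : Finset (Fin n))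
    (hKB : ∀ k, k ≠ i → k ∈ K ∨ k ∈ B) (h : (candidates K acc x).card + (I ∩ B).card < r) :
    i ∈ greedySelect r I acc x := by
  refine Finset.mem_filter.2 ⟨mem_candidates.2 ⟨hi, hx⟩, lt_of_le_of_lt ?_ h⟩
  refine le_trans (Finset.card_le_card fun k hk => ?_) (Finset.card_union_le _ _)
  obtain ⟨hkK, hki⟩ := Finset.mem_filter.1 hk
  obtain ⟨hkI, hkx⟩ := mem_candidates.1 hkK
  rcases hKB k hki.ne with h | h
  · exact Finset.mem_union_left _ (mem_candidates.2 ⟨h, hkx⟩)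
  · exact Finset.mem_union_right _ (Finset.mem_inter.2 ⟨hkI, h⟩)

lemma mem_greedySelect_of_card_le {n r : ℕ} {acc : Fin n → Set ℝ≥0}
    {x : Fin n → ℝ≥0} {i : Fin n} (hx : x i ∈ acc i)
    (h : (candidates Finset.univ acc x).card ≤ r) :
    i ∈ greedySelect r Finset.univ acc x := by
  have hi : i ∈ candidates Finset.univ acc x := mem_candidates.2 ⟨Finset.mem_univ _, hx⟩
  refine Finset.mem_filter.2 ⟨hi, lt_of_lt_of_le (Finset.card_lt_card ?_) h⟩
  exact Finset.filter_ssubset.2 ⟨i, hi, lt_irrefl i⟩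

lemma measurable_card_candidates {n : ℕ} (I : Finset (Fin n)) {acc : Fin n → Set ℝ≥0}
    (hacc : ∀ i, MeasurableSet (acc i)) : Measurable fun x => (candidates I acc x).card := by
  classical
  simp only [candidates, Finset.card_filter]
  exact Finset.measurable_sum _ fun i _ =>
    Measurable.ite (measurable_pi_apply i (hacc i)) measurable_const measurable_const

lemma filter_candidates_lt {n : ℕ} (I : Finset (Fin n)) (acc : Fin n → Set ℝ≥0)
    (x : Fin n → ℝ≥0) (i : Fin n) :
    (candidates I acc x).filter (· < i) = candidates (I.filter (· < i)) acc x := by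
  ext k; simp only [Finset.mem_filter, mem_candidates]; tauto

lemma measurableSet_mem_greedySelect {n : ℕ} (r : ℕ) (I : Finset (Fin n))
    {acc : Fin n → Set ℝ≥0} (hacc : ∀ i, MeasurableSet (acc i)) (i : Fin n) :
    MeasurableSet {x | i ∈ greedySelect r I acc x} := by
  have : {x | i ∈ greedySelect r I acc x} = {x | i ∈ I} ∩ ((fun x : Fin n → ℝ≥0 => x i) ⁻¹' acc i)
      ∩ {x | (candidates (I.filter (· < i)) acc x).card < r} := by
    ext x
    simp only [greedySelect, Finset.mem_filter, mem_candidates, filter_candidates_lt]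
    rfl
  rw [this]
  exact ((MeasurableSet.const _).inter (measurable_pi_apply i (hacc i))).inter
    (measurableSet_lt (measurable_card_candidates _ hacc) measurable_const)

/-- The deterministic algorithm that accepts the first `r` candidates. -/
def greedy {n : ℕ} (r : ℕ) (I : Finset (Fin n)) (acc : Fin n → Set ℝ≥0)
    (hacc : ∀ i, MeasurableSet (acc i)) : OnlineAlgorithm n r where
  Seed := Unit
  seedSpace := inferInstance
  seedLaw := Measure.dirac ()
  seedLaw_prob := inferInstance
  select := fun _ x => greedySelect r I acc x
  select_online := by
    intro _ i x x' h
    have h1 : candidates (I.filter (· < i)) acc x = candidates (I.filter (· < i)) acc x' := by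
      ext k
      simp only [mem_candidates, Finset.mem_filter]
      refine and_congr_right fun hk => ?_
      rw [h k hk.2.le]
    simp only [greedySelect, Finset.mem_filter, mem_candidates, filter_candidates_lt, h1,
      h i le_rfl]
  select_measurable := fun i =>
    measurable_snd (measurableSet_mem_greedySelect r I hacc i)
  select_card := fun _ x => card_greedySelect_le r I acc x

/-- The reward collected by the greedy algorithm on the arrivals `x`. -/
def greedyReward {n : ℕ} (r : ℕ) (I : Finset (Fin n)) (acc : Fin n → Set ℝ≥0)
    (x : Fin n → ℝ≥0) : ℝ :=
  ∑ i, (if i ∈ greedySelect r I acc x then (x i : ℝ) else 0)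

lemma greedyReward_nonneg {n : ℕ} (r : ℕ) (I : Finset (Fin n)) (acc : Fin n → Set ℝ≥0)
    (x : Fin n → ℝ≥0) : 0 ≤ greedyReward r I acc x :=
  Finset.sum_nonneg fun i _ => by split_ifs <;> simp

lemma measurable_greedyReward {n : ℕ} (r : ℕ) (I : Finset (Fin n)) {acc : Fin n → Set ℝ≥0}
    (hacc : ∀ i, MeasurableSet (acc i)) : Measurable (greedyReward r I acc) :=
  Finset.measurable_sum _ fun i _ => Measurable.ite (measurableSet_mem_greedySelect r I hacc i)
    (measurable_pi_apply i).coe_nnreal_real measurable_const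

lemma expectedReward_greedy {n m r : ℕ} (I : Finset (Fin n)) {acc : Fin n → Set ℝ≥0}
    (hacc : ∀ i, MeasurableSet (acc i)) (A : Matrix (Fin n) (Fin m) ℝ≥0)
    (μ : Fin m → Measure ℝ≥0) :
    expectedReward (greedy r I acc hacc) A μ
      = ∫⁻ y, ENNReal.ofReal (greedyReward r I acc (A.mulVec y)) ∂(Measure.pi μ) := by
  have h : expectedReward (greedy r I acc hacc) A μ
      = ∫⁻ _ω : Unit, ∫⁻ y, ((∑ i ∈ greedySelect r I acc (A.mulVec y), A.mulVec y i : ℝ≥0) : ℝ≥0∞)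
        ∂(Measure.pi μ) ∂(Measure.dirac ()) := rfl
  rw [h, lintegral_dirac]
  refine lintegral_congr fun y => ?_
  have : greedyReward r I acc (A.mulVec y)
      = ((∑ i ∈ greedySelect r I acc (A.mulVec y), A.mulVec y i : ℝ≥0) : ℝ) := by
    rw [greedyReward, ← Finset.sum_filter, NNReal.coe_sum]
    congr 1
    ext i; simp
  rw [this, ENNReal.ofReal_coe_nnreal]

lemma mul_min_le_greedyReward {n r : ℕ} (I : Finset (Fin n)) (acc : Fin n → Set ℝ≥0)
    (x : Fin n → ℝ≥0) (τ : ℝ) (hτ : 0 ≤ τ) (h : ∀ i, x i ∈ acc i → τ ≤ x i) :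
    τ * min ((candidates I acc x).card : ℝ) r ≤ greedyReward r I acc x := by
  have h1 : min ((candidates I acc x).card : ℝ) r ≤ ((greedySelect r I acc x).card : ℝ) := by
    exact_mod_cast min_card_candidates_le r I acc x
  refine (mul_le_mul_of_nonneg_left h1 hτ).trans ?_
  have h2 : greedyReward r I acc x = ∑ i ∈ greedySelect r I acc x, (x i : ℝ) := by
    rw [greedyReward, ← Finset.sum_filter]; congr 1; ext i; simp
  rw [h2, mul_comm, ← nsmul_eq_mul]
  exact Finset.card_nsmul_le_sum _ _ _ fun i hi =>
    h i (mem_candidates.1 (Finset.mem_filter.1 hi).1).2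

/-! ### Random subsets of the arrivals -/

/-- A uniformly random set contains `i` and at most half of `B` with probability at least `1/4`. -/
lemma card_le_four_mul_sum_subsets {n : ℕ} (i : Fin n) (B : Finset (Fin n)) (hi : i ∉ B) :
    (2 : ℝ) ^ n ≤ 4 * ∑ I : Finset (Fin n),
      if i ∈ I ∧ 2 * (I ∩ B).card ≤ B.card then (1 : ℝ) else 0 := by
  set g : Finset (Fin n) → ℝ := fun I => if i ∈ I ∧ 2 * (I ∩ B).card ≤ B.card then 1 else 0
  have hc : Function.Involutive (fun I : Finset (Fin n) => Iᶜ) := compl_involutive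
  have hd : Function.Involutive (fun I : Finset (Fin n) => symmDiff I {i}) := fun I =>
    symmDiff_symmDiff_cancel_right _ _
  have ec : ∀ f : Finset (Fin n) → ℝ, ∑ I, f Iᶜ = ∑ I, f I := fun f =>
    Equiv.sum_comp (hc.toPerm) f
  have ed : ∀ f : Finset (Fin n) → ℝ, ∑ I, f (symmDiff I {i}) = ∑ I, f I := fun f =>
    Equiv.sum_comp (hd.toPerm) f
  have hB : ∀ I : Finset (Fin n), symmDiff I {i} ∩ B = I ∩ B := fun I => by
    ext k
    simp only [Finset.mem_inter, Finset.mem_symmDiff, Finset.mem_singleton]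
    have : k ∈ B → k ≠ i := fun h h' => hi (h' ▸ h)
    tauto
  have hmem : ∀ I : Finset (Fin n), i ∈ symmDiff I {i} ↔ i ∉ I := fun I => by
    simp [Finset.mem_symmDiff]
  have hcard : ∀ I : Finset (Fin n), (I ∩ B).card + (Iᶜ ∩ B).card = B.card := fun I => by
    rw [← Finset.card_union_of_disjoint, ← Finset.union_inter_distrib_right]
    · simp
    · exact (disjoint_compl_right (a := I)).mono Finset.inter_subset_left Finset.inter_subset_left
  have h0 : ∀ I, 0 ≤ g I := fun I => by simp only [g]; split_ifs <;> norm_num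
  -- One of `I` and its complement contains at most half of `B`; toggling `i ∉ B` then puts `i` into
  -- the set without changing the intersection with `B`. Summing over all `I` gives the factor `4`,
  -- since complementation and toggling are bijections.
  have h1 : ∀ I, 1 ≤ g I + g Iᶜ + g (symmDiff I {i}) + g (symmDiff Iᶜ {i}) := by
    intro I
    have hh := hcard I
    have hone : ∀ J, i ∈ J → 2 * (J ∩ B).card ≤ B.card → 1 ≤ g J := fun J h h' => by
      simp [g, h, h']
    have a1 := h0 I
    have a2 := h0 Iᶜ
    have a3 := h0 (symmDiff I {i})
    have a4 := h0 (symmDiff Iᶜ {i})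
    by_cases hI : 2 * (I ∩ B).card ≤ B.card
    · by_cases hiI : i ∈ I
      · linarith [hone I hiI hI]
      · linarith [hone (symmDiff I {i}) ((hmem I).2 hiI) (by rwa [hB])]
    · have hI' : 2 * (Iᶜ ∩ B).card ≤ B.card := by omega
      by_cases hiI : i ∈ I
      · linarith [hone (symmDiff Iᶜ {i}) ((hmem _).2 (by simpa using hiI)) (by rwa [hB])]
      · linarith [hone Iᶜ (by simpa using hiI) hI']
  have h2 := Finset.sum_le_sum fun I (_ : I ∈ Finset.univ) => h1 I
  simp only [Finset.sum_add_distrib] at h2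
  rw [ec fun I => g (symmDiff I {i}), ed g, ec g] at h2
  simp only [Finset.sum_const, Finset.card_univ, Fintype.card_finset, Fintype.card_fin,
    nsmul_eq_mul, mul_one] at h2
  push_cast at h2
  linarith

/-! ### The threshold -/

/-- The values above the threshold `τ`; a value equal to `τ` is accepted for the arrivals in `D`. -/
def thresholdRegion {n : ℕ} (τ : ℝ≥0) (D : Finset (Fin n)) (i : Fin n) : Set ℝ≥0 :=
  {x | τ < x ∨ x = τ ∧ i ∈ D}

lemma measurableSet_thresholdRegion {n : ℕ} (τ : ℝ≥0) (D : Finset (Fin n)) (i : Fin n) :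
    MeasurableSet (thresholdRegion τ D i) := by
  have : thresholdRegion τ D i = Set.Ioi τ ∪ ({τ} ∩ {_x | i ∈ D}) := rfl
  rw [this]
  exact measurableSet_Ioi.union ((measurableSet_singleton τ).inter (MeasurableSet.const _))

/-- Take the infimum of the levels whose upper tail has mass at most `T`. Continuity from below
bounds the open tail there, continuity from above the closed one. -/
lemma exists_quantile (ν : Measure ℝ≥0) [IsFiniteMeasure ν] (T : ℝ≥0∞) (hT : 0 < T) :
    ∃ τ : ℝ≥0, ν (Set.Ioi τ) ≤ T ∧ (τ = 0 ∨ T ≤ ν (Set.Ici τ)) := by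
  set S : Set ℝ≥0 := {t | ν (Set.Ioi t) ≤ T} with hS
  have hne : S.Nonempty := by
    have hanti : Antitone fun k : ℕ => Set.Ioi (k : ℝ≥0) := fun a b hab =>
      Set.Ioi_subset_Ioi (by exact_mod_cast hab)
    have h := tendsto_measure_iInter_atTop (μ := ν) (s := fun k : ℕ => Set.Ioi (k : ℝ≥0))
      (fun k => (measurableSet_Ioi (a := (k : ℝ≥0))).nullMeasurableSet) hanti
      ⟨0, measure_ne_top _ _⟩
    have he : ⋂ k : ℕ, Set.Ioi (k : ℝ≥0) = ∅ := by
      ext t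
      obtain ⟨k, hk⟩ := exists_nat_gt t
      simp only [Set.mem_iInter, Set.mem_Ioi, Set.mem_empty_iff_false, iff_false, not_forall]
      exact ⟨k, not_lt.2 hk.le⟩
    rw [he, measure_empty] at h
    obtain ⟨k, hk⟩ := (h.eventually (gt_mem_nhds hT)).exists
    exact ⟨k, hk.le⟩
  refine ⟨sInf S, ?_, ?_⟩
  · obtain ⟨v, hv, hvgt, hvlim⟩ := exists_seq_strictAnti_tendsto (sInf S)
    have he : Set.Ioi (sInf S) = ⋃ k, Set.Ioi (v k) := by
      ext t
      simp only [Set.mem_iUnion, Set.mem_Ioi]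
      refine ⟨fun ht => (hvlim.eventually (gt_mem_nhds ht)).exists, ?_⟩
      rintro ⟨k, hk⟩
      exact (hvgt k).trans hk
    rw [he, Monotone.measure_iUnion fun a b hab => Set.Ioi_subset_Ioi (hv.antitone hab)]
    refine iSup_le fun k => ?_
    obtain ⟨t, ht, htv⟩ := exists_lt_of_csInf_lt hne (hvgt k)
    exact (measure_mono (Set.Ioi_subset_Ioi htv.le)).trans ht
  · rcases eq_or_lt_of_le (zero_le (a := sInf S)) with h0 | h0
    · exact Or.inl h0.symm
    right
    obtain ⟨v, hv, hvlt, hvlim⟩ := exists_seq_strictMono_tendsto' h0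
    have he : Set.Ici (sInf S) = ⋂ k, Set.Ioi (v k) := by
      ext t
      simp only [Set.mem_iInter, Set.mem_Ioi, Set.mem_Ici]
      exact ⟨fun ht k => (hvlt k).2.trans_le ht, fun h => le_of_tendsto' hvlim fun k => (h k).le⟩
    rw [he, Antitone.measure_iInter (fun a b hab => Set.Ioi_subset_Ioi (hv.monotone hab))
      (fun k => measurableSet_Ioi.nullMeasurableSet) ⟨0, measure_ne_top _ _⟩]
    refine le_iInf fun k => ?_
    by_contra hcon
    exact absurd (csInf_le (OrderBot.bddBelow S) (not_le.1 hcon).le) (not_le.2 (hvlt k).2)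

/-- There is a threshold for which the expected number of candidates is at most `T`, but about `T`
unless the threshold is zero. -/
theorem exists_threshold {Ω : Type*} [MeasurableSpace Ω] {P : Measure Ω} [IsProbabilityMeasure P]
    {n : ℕ} (X : Fin n → Ω → ℝ≥0) (hX : ∀ i, Measurable (X i)) (T : ℝ) (hT : 0 < T) :
    ∃ (τ : ℝ≥0) (D : Finset (Fin n)),
      ∑ i, P.real {y | X i y ∈ thresholdRegion τ D i} ≤ T ∧
      (τ = 0 ∨ T ≤ ∑ i, P.real {y | X i y ∈ thresholdRegion τ D i} ∨
        ∃ i₀, T ≤ ∑ i, P.real {y | X i y ∈ thresholdRegion τ D i} + P.real {y | X i₀ y = τ}) := by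
  classical
  set ν : Measure ℝ≥0 := ∑ i, P.map (X i) with hν
  have hmap : ∀ s, MeasurableSet s → ν.real s = ∑ i, P.real {y | X i y ∈ s} := by
    intro s hs
    rw [Measure.real, hν, Measure.finsetSum_apply, ENNReal.toReal_sum]
    · refine Finset.sum_congr rfl fun i _ => ?_
      rw [Measure.map_apply (hX i) hs]; rfl
    · intro i _
      rw [Measure.map_apply (hX i) hs]
      exact measure_ne_top _ _
  have hsplit : ∀ τ D i, P.real {y | X i y ∈ thresholdRegion τ D i}
      = P.real {y | X i y ∈ Set.Ioi τ} + if i ∈ D then P.real {y | X i y = τ} else 0 := by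
    intro τ D i
    by_cases hi : i ∈ D
    · rw [if_pos hi, ← measureReal_union]
      · congr 1; ext y; simp [thresholdRegion, hi]
      · rw [Set.disjoint_left]
        intro y hy hy'
        have h1 : τ < X i y := hy
        have h2 : X i y = τ := hy'
        exact absurd h2 h1.ne'
      · exact hX i (measurableSet_singleton τ)
    · rw [if_neg hi, add_zero]
      congr 1; ext y; simp [thresholdRegion, hi]
  obtain ⟨τ, h1, h2⟩ := exists_quantile ν (ENNReal.ofReal T) (ENNReal.ofReal_pos.2 hT)
  have h1' : ∑ i, P.real {y | X i y ∈ Set.Ioi τ} ≤ T := by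
    rw [← hmap _ measurableSet_Ioi]
    exact ENNReal.toReal_le_of_le_ofReal hT.le h1
  -- Ties at `τ` are admitted for a set `D` of maximal size that keeps the expected count at most
  -- `T`. Admitting ties for one more arrival `i₀` exceeds `T`, so the shortfall is at most a single
  -- atom.
  set S : Finset (Finset (Fin n)) := Finset.univ.filter fun D =>
    ∑ i, P.real {y | X i y ∈ thresholdRegion τ D i} ≤ T with hS
  have hne : S.Nonempty := ⟨∅, by simpa [hS, hsplit] using h1'⟩
  obtain ⟨D, hD, hmax⟩ := Finset.exists_max_image S Finset.card hne
  refine ⟨τ, D, (Finset.mem_filter.1 hD).2, ?_⟩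
  rcases h2 with h2 | h2
  · exact Or.inl h2
  right
  by_cases hDu : D = Finset.univ
  · left
    have h3 : T ≤ ν.real (Set.Ici τ) :=
      (ENNReal.ofReal_le_iff_le_toReal (measure_ne_top _ _)).1 h2
    rw [hmap _ measurableSet_Ici] at h3
    refine h3.trans (le_of_eq (Finset.sum_congr rfl fun i _ => ?_))
    congr 1; ext y
    simp [thresholdRegion, hDu, le_iff_lt_or_eq, eq_comm]
  · right
    obtain ⟨i₀, hi₀⟩ : ∃ i, i ∉ D := by
      by_contra hcon; push Not at hcon
      exact hDu (Finset.eq_univ_iff_forall.2 hcon)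
    refine ⟨i₀, ?_⟩
    have hni : insert i₀ D ∉ S := fun h => by
      have := hmax _ h
      rw [Finset.card_insert_of_notMem hi₀] at this
      omega
    have h3 : T < ∑ i, P.real {y | X i y ∈ thresholdRegion τ (insert i₀ D) i} := by
      by_contra hcon
      exact hni (Finset.mem_filter.2 ⟨Finset.mem_univ _, not_lt.1 hcon⟩)
    refine h3.le.trans (le_of_eq ?_)
    simp only [hsplit, Finset.sum_add_distrib, add_assoc]
    congr 1
    rw [← Finset.sum_filter, ← Finset.sum_filter, Finset.filter_univ_mem, Finset.filter_univ_mem,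
      Finset.sum_insert hi₀, add_comm]

/-! ### Candidates, and the split of their values into features -/

/-- The regions `acc i` consist of the values above `τ`, and possibly of `τ` itself. -/
structure IsThreshold {n : ℕ} (τ : ℝ≥0) (acc : Fin n → Set ℝ≥0) : Prop where
  measurableSet : ∀ i, MeasurableSet (acc i)
  le_of_mem : ∀ i x, x ∈ acc i → τ ≤ x
  mem_of_lt : ∀ i x, τ < x → x ∈ acc i

lemma isThreshold_thresholdRegion {n : ℕ} (τ : ℝ≥0) (D : Finset (Fin n)) :
    IsThreshold τ (thresholdRegion τ D) where
  measurableSet := measurableSet_thresholdRegion τ D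
  le_of_mem := by
    rintro i x (h | h)
    · exact h.le
    · exact h.1.ge
  mem_of_lt := fun _ _ h => Or.inl h

/-- The indicator of arrival `i` being a candidate. -/
def hit {n m : ℕ} (acc : Fin n → Set ℝ≥0) (A : Matrix (Fin n) (Fin m) ℝ≥0) (i : Fin n)
    (y : Fin m → ℝ≥0) : ℝ :=
  (acc i).indicator (fun _ => (1 : ℝ)) (A.mulVec y i)

/-- The number of candidates in `K`. -/
def hitCount {n m : ℕ} (acc : Fin n → Set ℝ≥0) (A : Matrix (Fin n) (Fin m) ℝ≥0)
    (K : Finset (Fin n)) (y : Fin m → ℝ≥0) : ℕ :=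
  (candidates K acc (A.mulVec y)).card

/-- The contribution `A i j * t`, if it exceeds `τ` by itself. -/
def bigPart {n m : ℕ} (τ : ℝ≥0) (A : Matrix (Fin n) (Fin m) ℝ≥0) (i : Fin n) (j : Fin m)
    (t : ℝ≥0) : ℝ :=
  if τ < A i j * t then (A i j * t : ℝ) else 0

/-- The contribution `A i j * t`, if it does not exceed `τ` by itself. -/
def smallPart {n m : ℕ} (τ : ℝ≥0) (A : Matrix (Fin n) (Fin m) ℝ≥0) (i : Fin n) (j : Fin m)
    (t : ℝ≥0) : ℝ :=
  if τ < A i j * t then 0 else (A i j * t : ℝ)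

/-- The part of the contribution of feature `j` to a candidate `i` that is controlled by leaving out
all arrivals which depend on feature `j`. The arrivals in `H` are the likely candidates. -/
def share {n m : ℕ} (τ : ℝ≥0) (acc : Fin n → Set ℝ≥0) (A : Matrix (Fin n) (Fin m) ℝ≥0)
    (H : Finset (Fin n)) (i : Fin n) (j : Fin m) (y : Fin m → ℝ≥0) : ℝ :=
  if i ∈ H then A i j * y j * hit acc A i y else bigPart τ A i j (y j)

/-- The part of the value of a candidate `i` that is controlled by its second moment. -/
def rest {n m : ℕ} (τ : ℝ≥0) (acc : Fin n → Set ℝ≥0) (A : Matrix (Fin n) (Fin m) ℝ≥0)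
    (H : Finset (Fin n)) (i : Fin n) (y : Fin m → ℝ≥0) : ℝ :=
  if i ∈ H then 0 else (∑ j, smallPart τ A i j (y j)) * hit acc A i y

lemma coe_mulVec {n m : ℕ} (A : Matrix (Fin n) (Fin m) ℝ≥0) (y : Fin m → ℝ≥0) (i : Fin n) :
    (A.mulVec y i : ℝ) = ∑ j, (A i j : ℝ) * y j := by
  simp [Matrix.mulVec, dotProduct]

lemma measurable_mulVec_apply {n m : ℕ} (A : Matrix (Fin n) (Fin m) ℝ≥0) (i : Fin n) :
    Measurable fun y : Fin m → ℝ≥0 => A.mulVec y i := by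
  simp only [Matrix.mulVec, dotProduct]
  fun_prop

lemma measurable_mulVec {n m : ℕ} (A : Matrix (Fin n) (Fin m) ℝ≥0) :
    Measurable fun y : Fin m → ℝ≥0 => A.mulVec y :=
  measurable_pi_lambda _ fun i => measurable_mulVec_apply A i

lemma mulVec_dependsOn {n m : ℕ} (A : Matrix (Fin n) (Fin m) ℝ≥0) (i : Fin n) :
    DependsOn (fun y : Fin m → ℝ≥0 => A.mulVec y i)
      (Finset.univ.filter fun j => A i j ≠ 0 : Finset (Fin m)) := by
  intro y y' h
  simp only [Matrix.mulVec, dotProduct]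
  refine Finset.sum_congr rfl fun j _ => ?_
  by_cases hj : A i j = 0
  · simp [hj]
  · have := h j (by simpa using hj)
    simp only [this]

lemma hit_eq_zero_or_one {n m : ℕ} (acc : Fin n → Set ℝ≥0) (A : Matrix (Fin n) (Fin m) ℝ≥0)
    (i : Fin n) (y : Fin m → ℝ≥0) :
    (A.mulVec y i ∉ acc i ∧ hit acc A i y = 0) ∨ (A.mulVec y i ∈ acc i ∧ hit acc A i y = 1) := by
  by_cases h : A.mulVec y i ∈ acc i
  · exact Or.inr ⟨h, by simp [hit, h]⟩
  · exact Or.inl ⟨h, by simp [hit, h]⟩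

lemma hit_nonneg {n m : ℕ} (acc : Fin n → Set ℝ≥0) (A : Matrix (Fin n) (Fin m) ℝ≥0)
    (i : Fin n) (y : Fin m → ℝ≥0) : 0 ≤ hit acc A i y := by
  rcases hit_eq_zero_or_one acc A i y with h | h <;> simp [h.2]

lemma hit_le_one {n m : ℕ} (acc : Fin n → Set ℝ≥0) (A : Matrix (Fin n) (Fin m) ℝ≥0)
    (i : Fin n) (y : Fin m → ℝ≥0) : hit acc A i y ≤ 1 := by
  rcases hit_eq_zero_or_one acc A i y with h | h <;> simp [h.2]

lemma abs_hit_le_one {n m : ℕ} (acc : Fin n → Set ℝ≥0) (A : Matrix (Fin n) (Fin m) ℝ≥0)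
    (i : Fin n) (y : Fin m → ℝ≥0) : |hit acc A i y| ≤ 1 := by
  rw [abs_of_nonneg (hit_nonneg _ _ _ _)]; exact hit_le_one _ _ _ _

lemma hit_sq {n m : ℕ} (acc : Fin n → Set ℝ≥0) (A : Matrix (Fin n) (Fin m) ℝ≥0)
    (i : Fin n) (y : Fin m → ℝ≥0) : hit acc A i y ^ 2 = hit acc A i y := by
  rcases hit_eq_zero_or_one acc A i y with h | h <;> simp [h.2]

lemma measurable_hit {n m : ℕ} {acc : Fin n → Set ℝ≥0} (hacc : ∀ i, MeasurableSet (acc i))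
    (A : Matrix (Fin n) (Fin m) ℝ≥0) (i : Fin n) : Measurable (hit acc A i) :=
  (measurable_const.indicator (hacc i)).comp (measurable_mulVec_apply A i)

lemma integral_hit {n m : ℕ} {acc : Fin n → Set ℝ≥0} (hacc : ∀ i, MeasurableSet (acc i))
    (A : Matrix (Fin n) (Fin m) ℝ≥0) (i : Fin n) (P : Measure (Fin m → ℝ≥0)) :
    ∫ y, hit acc A i y ∂P = P.real {y | A.mulVec y i ∈ acc i} := by
  have h : hit acc A i = ({y | A.mulVec y i ∈ acc i} : Set (Fin m → ℝ≥0)).indicator 1 := by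
    ext y; simp [hit, Set.indicator]
  rw [h]
  exact integral_indicator_one (measurable_mulVec_apply A i (hacc i))

lemma hit_dependsOn {n m : ℕ} (acc : Fin n → Set ℝ≥0) (A : Matrix (Fin n) (Fin m) ℝ≥0)
    (i : Fin n) : DependsOn (hit acc A i)
      (Finset.univ.filter fun j => A i j ≠ 0 : Finset (Fin m)) := by
  intro y y' h
  have h' : A.mulVec y i = A.mulVec y' i := mulVec_dependsOn A i h
  simp only [hit, h']

lemma hitCount_eq_sum {n m : ℕ} (acc : Fin n → Set ℝ≥0) (A : Matrix (Fin n) (Fin m) ℝ≥0)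
    (K : Finset (Fin n)) (y : Fin m → ℝ≥0) : (hitCount acc A K y : ℝ) = ∑ i ∈ K, hit acc A i y := by
  classical
  rw [hitCount, candidates, Finset.card_filter]
  push_cast
  refine Finset.sum_congr rfl fun i _ => ?_
  simp [hit, Set.indicator]

lemma measurable_hitCount {n m : ℕ} {acc : Fin n → Set ℝ≥0} (hacc : ∀ i, MeasurableSet (acc i))
    (A : Matrix (Fin n) (Fin m) ℝ≥0) (K : Finset (Fin n)) : Measurable (hitCount acc A K) :=
  (measurable_card_candidates K hacc).comp (measurable_mulVec A)

lemma hitCount_mono {n m : ℕ} (acc : Fin n → Set ℝ≥0) (A : Matrix (Fin n) (Fin m) ℝ≥0)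
    {K K' : Finset (Fin n)} (h : K ⊆ K') (y : Fin m → ℝ≥0) :
    hitCount acc A K y ≤ hitCount acc A K' y :=
  Finset.card_le_card fun i hi => by
    rw [mem_candidates] at hi ⊢
    exact ⟨h hi.1, hi.2⟩

/-- The arrivals that do not depend on feature `j`. -/
def unaffected {n m : ℕ} (A : Matrix (Fin n) (Fin m) ℝ≥0) (j : Fin m) : Finset (Fin n) :=
  Finset.univ.filter fun i => A i j = 0

/-- This is what makes the event of leaving room independent of feature `j`. -/
lemma hitCount_unaffected_dependsOn {n m : ℕ} (acc : Fin n → Set ℝ≥0)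
    (A : Matrix (Fin n) (Fin m) ℝ≥0) (j : Fin m) :
    DependsOn (hitCount acc A (unaffected A j)) {j}ᶜ := by
  intro y y' h
  unfold hitCount
  congr 1
  ext i
  simp only [mem_candidates, unaffected, Finset.mem_filter, Finset.mem_univ, true_and]
  refine and_congr_right fun hi => ?_
  have : A.mulVec y i = A.mulVec y' i := mulVec_dependsOn A i fun k hk => h k fun hkj => by
    rw [Set.mem_singleton_iff.1 hkj] at hk
    simp [hi] at hk
  rw [this]

/-! ### Moments of the number of candidates -/

/-- `variance_sum_le` applied to the indicators, each of whose variances is at most its mean. -/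
lemma integral_hitCount_sq_le {n m s : ℕ} {acc : Fin n → Set ℝ≥0}
    (hacc : ∀ i, MeasurableSet (acc i)) (A : Matrix (Fin n) (Fin m) ℝ≥0) (μ : Fin m → Measure ℝ≥0)
    [∀ j, IsProbabilityMeasure (μ j)]
    (hs : ∀ j, (Finset.univ.filter fun i => A i j ≠ 0).card ≤ s) :
    ∫ y, (hitCount acc A Finset.univ y : ℝ) ^ 2 ∂(Measure.pi μ)
      ≤ s * ∑ i, ∫ y, hit acc A i y ∂(Measure.pi μ)
        + (∑ i, ∫ y, hit acc A i y ∂(Measure.pi μ)) ^ 2 := by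
  have h := variance_sum_le s μ (fun i => Finset.univ.filter fun j => A i j ≠ 0) (hit acc A) 1
    (measurable_hit hacc A) (abs_hit_le_one acc A) (hit_dependsOn acc A)
    (by simpa using hs)
  rw [integral_finsetSum _ fun i _ =>
    integrable_of_abs_le (measurable_hit hacc A i) (abs_hit_le_one acc A i)] at h
  simp only [hitCount_eq_sum]
  have h2 : ∑ i, (∫ y, hit acc A i y ^ 2 ∂(Measure.pi μ) - (∫ y, hit acc A i y ∂(Measure.pi μ)) ^ 2)
      ≤ ∑ i, ∫ y, hit acc A i y ∂(Measure.pi μ) := by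
    refine Finset.sum_le_sum fun i _ => ?_
    simp only [hit_sq]
    linarith [sq_nonneg (∫ y, hit acc A i y ∂(Measure.pi μ))]
  linarith [mul_le_mul_of_nonneg_left h2 (Nat.cast_nonneg (α := ℝ) s)]

lemma integral_hitCount {n m : ℕ} {acc : Fin n → Set ℝ≥0}
    (hacc : ∀ i, MeasurableSet (acc i)) (A : Matrix (Fin n) (Fin m) ℝ≥0)
    (P : Measure (Fin m → ℝ≥0)) [IsProbabilityMeasure P] :
    ∫ y, (hitCount acc A Finset.univ y : ℝ) ∂P = ∑ i, ∫ y, hit acc A i y ∂P := by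
  simp only [hitCount_eq_sum]
  exact integral_finsetSum _ fun i _ =>
    integrable_of_abs_le (measurable_hit hacc A i) (abs_hit_le_one acc A i)

lemma hitCount_le {n m : ℕ} (acc : Fin n → Set ℝ≥0) (A : Matrix (Fin n) (Fin m) ℝ≥0)
    (K : Finset (Fin n)) (y : Fin m → ℝ≥0) : hitCount acc A K y ≤ n := by
  simpa [hitCount] using Finset.card_le_univ (candidates K acc (A.mulVec y))

/-! ### The small parts of unlikely candidates -/

lemma smallPart_nonneg {n m : ℕ} (τ : ℝ≥0) (A : Matrix (Fin n) (Fin m) ℝ≥0) (i : Fin n)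
    (j : Fin m) (t : ℝ≥0) : 0 ≤ smallPart τ A i j t := by
  unfold smallPart; split_ifs <;> positivity

lemma smallPart_le {n m : ℕ} (τ : ℝ≥0) (A : Matrix (Fin n) (Fin m) ℝ≥0) (i : Fin n)
    (j : Fin m) (t : ℝ≥0) : smallPart τ A i j t ≤ τ := by
  unfold smallPart
  split_ifs with h
  · positivity
  · exact_mod_cast not_lt.1 h

lemma smallPart_le_mul {n m : ℕ} (τ : ℝ≥0) (A : Matrix (Fin n) (Fin m) ℝ≥0) (i : Fin n)
    (j : Fin m) (t : ℝ≥0) : smallPart τ A i j t ≤ A i j * t := by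
  unfold smallPart
  split_ifs with h
  · positivity
  · exact le_rfl

lemma bigPart_nonneg {n m : ℕ} (τ : ℝ≥0) (A : Matrix (Fin n) (Fin m) ℝ≥0) (i : Fin n)
    (j : Fin m) (t : ℝ≥0) : 0 ≤ bigPart τ A i j t := by
  unfold bigPart; split_ifs <;> positivity

lemma bigPart_le_mul {n m : ℕ} (τ : ℝ≥0) (A : Matrix (Fin n) (Fin m) ℝ≥0) (i : Fin n)
    (j : Fin m) (t : ℝ≥0) : bigPart τ A i j t ≤ A i j * t := by
  unfold bigPart
  split_ifs with h
  · exact le_rfl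
  · positivity

lemma bigPart_add_smallPart {n m : ℕ} (τ : ℝ≥0) (A : Matrix (Fin n) (Fin m) ℝ≥0) (i : Fin n)
    (j : Fin m) (t : ℝ≥0) : bigPart τ A i j t + smallPart τ A i j t = A i j * t := by
  unfold bigPart smallPart; split_ifs <;> simp

lemma measurable_smallPart {n m : ℕ} (τ : ℝ≥0) (A : Matrix (Fin n) (Fin m) ℝ≥0) (i : Fin n)
    (j : Fin m) : Measurable (smallPart τ A i j) :=
  Measurable.ite (measurableSet_lt measurable_const (by fun_prop)) measurable_const (by fun_prop)

lemma measurable_bigPart {n m : ℕ} (τ : ℝ≥0) (A : Matrix (Fin n) (Fin m) ℝ≥0) (i : Fin n)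
    (j : Fin m) : Measurable (bigPart τ A i j) :=
  Measurable.ite (measurableSet_lt measurable_const (by fun_prop)) (by fun_prop) measurable_const

/-- By nonnegativity, a single contribution above `τ` already makes `i` a candidate. The candidate
indicator, which involves other features, can therefore be dropped. -/
lemma bigPart_mul_hit {n m : ℕ} {τ : ℝ≥0} {acc : Fin n → Set ℝ≥0} (hacc : IsThreshold τ acc)
    (A : Matrix (Fin n) (Fin m) ℝ≥0) (i : Fin n) (j : Fin m) (y : Fin m → ℝ≥0) :
    bigPart τ A i j (y j) * hit acc A i y = bigPart τ A i j (y j) := by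
  by_cases h : τ < A i j * y j
  · have hle : A i j * y j ≤ A.mulVec y i :=
      Finset.single_le_sum (f := fun k => A i k * y k) (fun _ _ => zero_le) (Finset.mem_univ j)
    have : A.mulVec y i ∈ acc i := hacc.mem_of_lt i _ (h.trans_le hle)
    simp [hit, this]
  · simp [bigPart, h]

/-- With `Z` the sum of the small parts, the restart inequality at level `τ` gives `𝔼 ((Z - 2τ)⁺)² ≤
p 𝔼 Z²`, since `Z > τ` makes `i` a candidate. This bounds first `𝔼 Z²` and then its part on the
candidate event. -/
lemma integral_smallPart_sq_mul_hit_le {n m : ℕ} {τ : ℝ≥0} {acc : Fin n → Set ℝ≥0}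
    (hacc : IsThreshold τ acc) (A : Matrix (Fin n) (Fin m) ℝ≥0) (μ : Fin m → Measure ℝ≥0)
    [∀ j, IsProbabilityMeasure (μ j)] (i : Fin n)
    (hp : ∫ y, hit acc A i y ∂(Measure.pi μ) ≤ 1 / 4) :
    ∫ y, (∑ j, smallPart τ A i j (y j)) ^ 2 * hit acc A i y ∂(Measure.pi μ)
      ≤ 40 * τ ^ 2 * ∫ y, hit acc A i y ∂(Measure.pi μ) := by
  set P := Measure.pi μ
  set p := ∫ y, hit acc A i y ∂P
  set Z : (Fin m → ℝ≥0) → ℝ := fun y => ∑ j, smallPart τ A i j (y j) with hZ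
  set e : (Fin m → ℝ≥0) → ℝ := fun y => max (Z y - τ - τ) 0 with he
  have hτ : (0 : ℝ) ≤ τ := τ.coe_nonneg
  have hZm : Measurable Z := Finset.measurable_sum _ fun j _ =>
    (measurable_smallPart τ A i j).comp (measurable_pi_apply j)
  have hZ0 : ∀ y, 0 ≤ Z y := fun y => Finset.sum_nonneg fun j _ => smallPart_nonneg _ _ _ _ _
  have hZb : ∀ y, Z y ≤ m * τ := fun y => by
    have := Finset.sum_le_card_nsmul Finset.univ (fun k : Fin m => smallPart τ A i k (y k)) τ
      fun k _ => smallPart_le _ _ _ _ _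
    simpa using this
  have he0 : ∀ y, 0 ≤ e y := fun y => le_max_right _ _
  have heZ : ∀ y, e y ≤ Z y := fun y => max_le (by linarith) (hZ0 y)
  have hem : Measurable e := by fun_prop
  have hqm := measurable_hit hacc.measurableSet A i
  have iq : Integrable (hit acc A i) P := integrable_of_abs_le hqm (abs_hit_le_one acc A i)
  have sqb : ∀ {x : ℝ}, 0 ≤ x → x ≤ m * τ → |x ^ 2| ≤ (m * τ) ^ 2 := fun {x} h h' => by
    rw [abs_pow, abs_of_nonneg h]; exact pow_le_pow_left₀ h h' 2
  have iZ : Integrable (fun y => Z y ^ 2) P :=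
    integrable_of_abs_le (hZm.pow_const 2) fun y => sqb (hZ0 y) (hZb y)
  have ie : Integrable (fun y => e y ^ 2) P :=
    integrable_of_abs_le (hem.pow_const 2) fun y => sqb (he0 y) ((heZ y).trans (hZb y))
  have hp0 : 0 ≤ p := integral_nonneg fun y => hit_nonneg _ _ _ _
  have h1 : ∫ y, e y ^ 2 ∂P ≤ p * ∫ y, Z y ^ 2 ∂P := by
    refine (integral_excess_sq_le μ τ hτ (smallPart τ A i) (measurable_smallPart τ A i)
      (smallPart_nonneg τ A i) (smallPart_le τ A i) τ hτ).trans ?_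
    refine mul_le_mul_of_nonneg_right ?_ (integral_nonneg fun y => sq_nonneg _)
    refine integral_mono_of_nonneg (Eventually.of_forall fun y =>
      Set.indicator_nonneg (fun _ _ => zero_le_one) _) iq (Eventually.of_forall fun y => ?_)
    change (Set.Ioi (τ : ℝ)).indicator (1 : ℝ → ℝ) (Z y) ≤ hit acc A i y
    by_cases h : (τ : ℝ) < Z y
    · have hX : Z y ≤ A.mulVec y i := by
        rw [coe_mulVec]; exact Finset.sum_le_sum fun j _ => smallPart_le_mul _ _ _ _ _
      have : A.mulVec y i ∈ acc i := hacc.mem_of_lt i _ (by exact_mod_cast h.trans_le hX)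
      simp [hit, this, h]
    · simp [h, hit_nonneg]
  have hZe : ∀ y, Z y ^ 2 ≤ 8 * τ ^ 2 + 2 * e y ^ 2 := fun y => by
    have h : Z y ≤ 2 * τ + e y := by have := le_max_left (Z y - τ - τ) 0; simp only [he]; linarith
    nlinarith [hZ0 y, he0 y, sq_nonneg (2 * (τ : ℝ) - e y)]
  have h2 : ∫ y, Z y ^ 2 ∂P ≤ 8 * τ ^ 2 + 2 * ∫ y, e y ^ 2 ∂P := by
    refine (integral_mono iZ ((integrable_const _).add (ie.const_mul 2)) hZe).trans (le_of_eq ?_)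
    rw [integral_add' (integrable_const _) (ie.const_mul 2)]
    simp [integral_const_mul]
  have hM0 : 0 ≤ ∫ y, Z y ^ 2 ∂P := integral_nonneg fun y => sq_nonneg _
  -- Self-bounding: `𝔼 Z² ≤ 8τ² + 2p 𝔼 Z²`, where `2p ≤ 1/2`. Inserted below, this gives `8τ²p + 2p
  -- · 16τ² = 40τ²p`.
  have h3 : ∫ y, Z y ^ 2 ∂P ≤ 16 * τ ^ 2 := by nlinarith
  have h4 : ∫ y, Z y ^ 2 * hit acc A i y ∂P ≤ 8 * τ ^ 2 * p + 2 * ∫ y, e y ^ 2 ∂P := by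
    rw [← integral_const_mul, ← integral_const_mul,
      ← integral_add (iq.const_mul _) (ie.const_mul _)]
    refine integral_mono_of_nonneg
      (Eventually.of_forall fun y => mul_nonneg (sq_nonneg _) (hit_nonneg _ _ _ _))
      ((iq.const_mul _).add (ie.const_mul _)) (Eventually.of_forall fun y => ?_)
    simp only
    rcases hit_eq_zero_or_one acc A i y with h | h
    · rw [h.2]; nlinarith [sq_nonneg (e y)]
    · rw [h.2]; linarith [hZe y]
  have h5 : p * ∫ y, Z y ^ 2 ∂P ≤ p * (16 * τ ^ 2) := mul_le_mul_of_nonneg_left h3 hp0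
  linarith

section Rest

variable {n m : ℕ} {τ : ℝ≥0} {acc : Fin n → Set ℝ≥0}

lemma rest_nonneg (A : Matrix (Fin n) (Fin m) ℝ≥0) (H : Finset (Fin n)) (i : Fin n)
    (y : Fin m → ℝ≥0) : 0 ≤ rest τ acc A H i y := by
  unfold rest
  split_ifs
  · exact le_rfl
  · exact mul_nonneg (Finset.sum_nonneg fun j _ => smallPart_nonneg _ _ _ _ _) (hit_nonneg _ _ _ _)

lemma rest_le (A : Matrix (Fin n) (Fin m) ℝ≥0) (H : Finset (Fin n)) (i : Fin n)
    (y : Fin m → ℝ≥0) : rest τ acc A H i y ≤ m * τ := by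
  unfold rest
  split_ifs
  · positivity
  · have h := Finset.sum_le_card_nsmul Finset.univ (fun k : Fin m => smallPart τ A i k (y k)) τ
      fun k _ => smallPart_le _ _ _ _ _
    have h' : ∑ k, smallPart τ A i k (y k) ≤ m * τ := by simpa using h
    have h0 : 0 ≤ ∑ k, smallPart τ A i k (y k) :=
      Finset.sum_nonneg fun j _ => smallPart_nonneg _ _ _ _ _
    exact (mul_le_of_le_one_right h0 (hit_le_one _ _ _ _)).trans h'

lemma abs_rest_le (A : Matrix (Fin n) (Fin m) ℝ≥0) (H : Finset (Fin n)) (i : Fin n)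
    (y : Fin m → ℝ≥0) : |rest τ acc A H i y| ≤ m * τ := by
  rw [abs_of_nonneg (rest_nonneg _ _ _ _)]; exact rest_le _ _ _ _

lemma measurable_rest (hacc : IsThreshold τ acc) (A : Matrix (Fin n) (Fin m) ℝ≥0)
    (H : Finset (Fin n)) (i : Fin n) : Measurable (rest τ acc A H i) := by
  unfold rest
  split_ifs
  · exact measurable_const
  · exact (Finset.measurable_sum _ fun j _ =>
      (measurable_smallPart τ A i j).comp (measurable_pi_apply j)).mul
        (measurable_hit hacc.measurableSet A i)

lemma rest_dependsOn (A : Matrix (Fin n) (Fin m) ℝ≥0) (H : Finset (Fin n)) (i : Fin n) :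
    DependsOn (rest τ acc A H i) (Finset.univ.filter fun j => A i j ≠ 0 : Finset (Fin m)) := by
  intro y y' h
  unfold rest
  rw [hit_dependsOn acc A i h]
  congr 2
  refine Finset.sum_congr rfl fun j _ => ?_
  by_cases hj : A i j = 0
  · simp [smallPart, hj]
  · rw [h j (by simpa using hj)]

lemma integral_rest_sq_le (hacc : IsThreshold τ acc) (A : Matrix (Fin n) (Fin m) ℝ≥0)
    (μ : Fin m → Measure ℝ≥0) [∀ j, IsProbabilityMeasure (μ j)] {H : Finset (Fin n)}
    (hH : ∀ i, i ∉ H → ∫ y, hit acc A i y ∂(Measure.pi μ) ≤ 1 / 4) (i : Fin n) :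
    ∫ y, rest τ acc A H i y ^ 2 ∂(Measure.pi μ)
      ≤ 40 * τ ^ 2 * ∫ y, hit acc A i y ∂(Measure.pi μ) := by
  by_cases hi : i ∈ H
  · have : 0 ≤ ∫ y, hit acc A i y ∂(Measure.pi μ) := integral_nonneg fun y => hit_nonneg _ _ _ _
    simp only [rest, hi, if_true]
    simp; positivity
  · simp only [rest, hi, if_false, mul_pow, hit_sq]
    exact integral_smallPart_sq_mul_hit_le hacc A μ i (hH i hi)

/-- The rest `R` vanishes off the candidate event, so `2τR ≤ R² + τ² · hit`. The second-moment bound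
then gives `41τ²p ≤ 2τ · 21τp`. -/
lemma integral_rest_le (hacc : IsThreshold τ acc) (A : Matrix (Fin n) (Fin m) ℝ≥0)
    (μ : Fin m → Measure ℝ≥0) [∀ j, IsProbabilityMeasure (μ j)] {H : Finset (Fin n)}
    (hH : ∀ i, i ∉ H → ∫ y, hit acc A i y ∂(Measure.pi μ) ≤ 1 / 4) (i : Fin n) :
    ∫ y, rest τ acc A H i y ∂(Measure.pi μ) ≤ 21 * τ * ∫ y, hit acc A i y ∂(Measure.pi μ) := by
  have h2 := integral_rest_sq_le hacc A μ hH i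
  have hp : 0 ≤ ∫ y, hit acc A i y ∂(Measure.pi μ) := integral_nonneg fun y => hit_nonneg _ _ _ _
  have ir : Integrable (rest τ acc A H i) (Measure.pi μ) :=
    integrable_of_abs_le (measurable_rest hacc A H i) (abs_rest_le A H i)
  have ir2 : Integrable (fun y => rest τ acc A H i y ^ 2) (Measure.pi μ) :=
    integrable_of_abs_le (B := (m * τ) ^ 2) ((measurable_rest hacc A H i).pow_const 2) fun y => by
      rw [abs_pow]; exact pow_le_pow_left₀ (abs_nonneg _) (abs_rest_le A H i y) 2
  have iq : Integrable (hit acc A i) (Measure.pi μ) :=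
    integrable_of_abs_le (measurable_hit hacc.measurableSet A i) (abs_hit_le_one acc A i)
  rcases eq_or_lt_of_le (zero_le (a := τ)) with h0 | h0
  · have : ∀ y, rest τ acc A H i y = 0 := fun y => by
      have h := rest_le (τ := τ) (acc := acc) A H i y
      have h' := rest_nonneg (τ := τ) (acc := acc) A H i y
      rw [← h0] at h h' ⊢
      simp at h; linarith
    simp only [this]
    simp [← h0]
  · have hτ : (0 : ℝ) < τ := h0
    have h3 : 2 * τ * ∫ y, rest τ acc A H i y ∂(Measure.pi μ)
        ≤ ∫ y, rest τ acc A H i y ^ 2 ∂(Measure.pi μ)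
          + τ ^ 2 * ∫ y, hit acc A i y ∂(Measure.pi μ) := by
      rw [← integral_const_mul, ← integral_const_mul, ← integral_add ir2 (iq.const_mul _)]
      refine integral_mono (ir.const_mul _) (ir2.add (iq.const_mul _)) fun y => ?_
      simp only
      rcases hit_eq_zero_or_one acc A i y with h | h
      · have : rest τ acc A H i y = 0 := by simp [rest, h.2]
        rw [this, h.2]; simp
      · rw [h.2]; nlinarith [sq_nonneg (rest τ acc A H i y - τ)]
    have h4 : (2 * τ) * ∫ y, rest τ acc A H i y ∂(Measure.pi μ)
        ≤ (2 * τ) * (21 * τ * ∫ y, hit acc A i y ∂(Measure.pi μ)) := by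
      have : 0 ≤ (τ : ℝ) ^ 2 * ∫ y, hit acc A i y ∂(Measure.pi μ) := by positivity
      linarith
    exact le_of_mul_le_mul_left h4 (by linarith)

/-- The variance of the total of the small parts. -/
lemma variance_sum_rest_le {s : ℕ} (hacc : IsThreshold τ acc) (A : Matrix (Fin n) (Fin m) ℝ≥0)
    (μ : Fin m → Measure ℝ≥0) [∀ j, IsProbabilityMeasure (μ j)] {H : Finset (Fin n)}
    (hs : ∀ j, (Finset.univ.filter fun i => A i j ≠ 0).card ≤ s)
    (hH : ∀ i, i ∉ H → ∫ y, hit acc A i y ∂(Measure.pi μ) ≤ 1 / 4) :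
    ∫ y, (∑ i, rest τ acc A H i y - ∫ z, ∑ i, rest τ acc A H i z ∂(Measure.pi μ)) ^ 2
        ∂(Measure.pi μ)
      ≤ s * (40 * τ ^ 2 * ∑ i, ∫ y, hit acc A i y ∂(Measure.pi μ)) := by
  rw [integral_sub_mean_sq (B := ∑ _i : Fin n, (m * τ : ℝ))
    (Finset.measurable_sum _ fun i _ => measurable_rest hacc A H i) fun y =>
      (Finset.abs_sum_le_sum_abs _ _).trans (Finset.sum_le_sum fun i _ => abs_rest_le A H i y)]
  refine (variance_sum_le s μ (fun i => Finset.univ.filter fun j => A i j ≠ 0)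
    (rest τ acc A H) (m * τ) (measurable_rest hacc A H) (abs_rest_le A H)
    (rest_dependsOn A H) (by simpa using hs)).trans ?_
  refine mul_le_mul_of_nonneg_left ?_ (Nat.cast_nonneg _)
  rw [Finset.mul_sum]
  refine Finset.sum_le_sum fun i _ => ?_
  linarith [integral_rest_sq_le hacc A μ hH i, sq_nonneg (∫ y, rest τ acc A H i y ∂(Measure.pi μ))]

end Rest

/-! ### Leaving out the arrivals that depend on a feature -/

/-- The indicator of at most `h` candidates among the arrivals that do not depend on feature `j`. -/
def slack {n m : ℕ} (acc : Fin n → Set ℝ≥0) (A : Matrix (Fin n) (Fin m) ℝ≥0) (h : ℕ) (j : Fin m)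
    (y : Fin m → ℝ≥0) : ℝ :=
  if hitCount acc A (unaffected A j) y ≤ h then 1 else 0

section Share

variable {n m : ℕ} {τ : ℝ≥0} {acc : Fin n → Set ℝ≥0}

lemma slack_nonneg (A : Matrix (Fin n) (Fin m) ℝ≥0) (h : ℕ) (j : Fin m) (y : Fin m → ℝ≥0) :
    0 ≤ slack acc A h j y := by
  unfold slack; split_ifs <;> norm_num

lemma slack_le_one (A : Matrix (Fin n) (Fin m) ℝ≥0) (h : ℕ) (j : Fin m) (y : Fin m → ℝ≥0) :
    slack acc A h j y ≤ 1 := by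
  unfold slack; split_ifs <;> norm_num

lemma measurable_slack (hacc : ∀ i, MeasurableSet (acc i)) (A : Matrix (Fin n) (Fin m) ℝ≥0)
    (h : ℕ) (j : Fin m) : Measurable (slack acc A h j) :=
  Measurable.ite (measurableSet_le (measurable_hitCount hacc A _) measurable_const)
    measurable_const measurable_const

lemma share_nonneg (A : Matrix (Fin n) (Fin m) ℝ≥0) (H : Finset (Fin n)) (i : Fin n) (j : Fin m)
    (y : Fin m → ℝ≥0) : 0 ≤ share τ acc A H i j y := by
  unfold share
  split_ifs
  · exact mul_nonneg (by positivity) (hit_nonneg _ _ _ _)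
  · exact bigPart_nonneg _ _ _ _ _

lemma share_le (A : Matrix (Fin n) (Fin m) ℝ≥0) (H : Finset (Fin n)) (i : Fin n) (j : Fin m)
    (y : Fin m → ℝ≥0) : share τ acc A H i j y ≤ A i j * y j := by
  unfold share
  split_ifs
  · exact mul_le_of_le_one_right (by positivity) (hit_le_one _ _ _ _)
  · exact bigPart_le_mul _ _ _ _ _

lemma share_eq_zero_of_apply (A : Matrix (Fin n) (Fin m) ℝ≥0) (H : Finset (Fin n)) (i : Fin n)
    (j : Fin m) (y : Fin m → ℝ≥0) (h : A i j = 0) : share τ acc A H i j y = 0 :=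
  le_antisymm ((share_le A H i j y).trans (by simp [h])) (share_nonneg A H i j y)

lemma share_mul_hit (hacc : IsThreshold τ acc) (A : Matrix (Fin n) (Fin m) ℝ≥0)
    (H : Finset (Fin n)) (i : Fin n) (j : Fin m) (y : Fin m → ℝ≥0) :
    share τ acc A H i j y * hit acc A i y = share τ acc A H i j y := by
  unfold share
  split_ifs
  · rw [mul_assoc, ← sq, hit_sq]
  · exact bigPart_mul_hit hacc A i j y

lemma sum_share_add_rest (hacc : IsThreshold τ acc) (A : Matrix (Fin n) (Fin m) ℝ≥0)
    (H : Finset (Fin n)) (i : Fin n) (y : Fin m → ℝ≥0) :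
    ∑ j, share τ acc A H i j y + rest τ acc A H i y = A.mulVec y i * hit acc A i y := by
  rw [coe_mulVec]
  by_cases hi : i ∈ H
  · simp [share, rest, hi, Finset.sum_mul]
  · simp only [share, rest, hi, if_false, ← bigPart_add_smallPart τ A i, Finset.sum_add_distrib,
      add_mul]
    congr 1
    rw [Finset.sum_mul]
    exact Finset.sum_congr rfl fun j _ => (bigPart_mul_hit hacc A i j y).symm

lemma measurable_share (hacc : IsThreshold τ acc) (A : Matrix (Fin n) (Fin m) ℝ≥0)
    (H : Finset (Fin n)) (i : Fin n) (j : Fin m) : Measurable (share τ acc A H i j) := by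
  unfold share
  split_ifs
  · have := measurable_hit hacc.measurableSet A i
    fun_prop
  · exact (measurable_bigPart τ A i j).comp (measurable_pi_apply j)

lemma integrable_share (hacc : IsThreshold τ acc) (A : Matrix (Fin n) (Fin m) ℝ≥0)
    {P : Measure (Fin m → ℝ≥0)} (H : Finset (Fin n)) (i : Fin n) (j : Fin m)
    (hAY : Integrable (fun y : Fin m → ℝ≥0 => (A i j * y j : ℝ)) P) :
    Integrable (share τ acc A H i j) P :=
  hAY.mono' (measurable_share hacc A H i j).aestronglyMeasurable
    (Eventually.of_forall fun y => by
      rw [Real.norm_of_nonneg (share_nonneg _ _ _ _ _)]; exact share_le _ _ _ _ _)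

lemma integrable_share_mul_slack (hacc : IsThreshold τ acc) (A : Matrix (Fin n) (Fin m) ℝ≥0)
    {P : Measure (Fin m → ℝ≥0)} (H : Finset (Fin n)) (h : ℕ) (i : Fin n) (j : Fin m)
    (hAY : Integrable (fun y : Fin m → ℝ≥0 => (A i j * y j : ℝ)) P) :
    Integrable (fun y => share τ acc A H i j y * slack acc A h j y) P :=
  hAY.mono' ((measurable_share hacc A H i j).mul
    (measurable_slack hacc.measurableSet A h j)).aestronglyMeasurable
    (Eventually.of_forall fun y => by
      rw [Real.norm_of_nonneg (mul_nonneg (share_nonneg _ _ _ _ _) (slack_nonneg _ _ _ _))]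
      exact (mul_le_of_le_one_right (share_nonneg _ _ _ _ _) (slack_le_one _ _ _ _)).trans
        (share_le _ _ _ _ _))

/-- The slack for `j` does not depend on `y j`, so the integral factorizes, and lack of room among
the unaffected arrivals implies more than `h` candidates overall. -/
lemma integral_coord_mul_one_sub_slack_le (hacc : ∀ i, MeasurableSet (acc i))
    (A : Matrix (Fin n) (Fin m) ℝ≥0) (μ : Fin m → Measure ℝ≥0) [∀ j, IsProbabilityMeasure (μ j)]
    {h : ℕ} {δ : ℝ} (hδ : (Measure.pi μ).real {y | h < hitCount acc A Finset.univ y} ≤ δ)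
    (j : Fin m) (φ : ℝ≥0 → ℝ) (hφ : ∀ t, 0 ≤ φ t) :
    ∫ y, φ (y j) * (1 - slack acc A h j y) ∂(Measure.pi μ)
      ≤ δ * ∫ y, φ (y j) ∂(Measure.pi μ) := by
  have hdep : DependsOn (fun y => 1 - slack acc A h j y) {j}ᶜ := by
    intro y y' hy
    simp only [slack, hitCount_unaffected_dependsOn acc A j hy]
  rw [integral_coord_mul μ j φ _ hdep, mul_comm]
  refine mul_le_mul_of_nonneg_right (le_trans ?_ hδ) (integral_nonneg fun y => hφ _)
  have h1 : (fun y => 1 - slack acc A h j y)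
      = ({y | h < hitCount acc A (unaffected A j) y} : Set (Fin m → ℝ≥0)).indicator 1 := by
    ext y
    by_cases hy : hitCount acc A (unaffected A j) y ≤ h
    · simp [slack, hy]
    · simp [slack, hy, not_le.1 hy]
  rw [h1, integral_indicator_one (measurableSet_lt measurable_const (measurable_hitCount hacc A _))]
  refine measureReal_mono fun y hy => ?_
  exact lt_of_lt_of_le hy (hitCount_mono acc A (Finset.subset_univ _) y)

/-- For `i ∉ H` the shares are functions of one coordinate, and independence applies directly. For
`i ∈ H` they are first bounded by `A i j * y j`; the extra term pays for dropping the candidate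
indicator. -/
lemma sum_integral_share_mul_one_sub_slack_le (hacc : IsThreshold τ acc)
    (A : Matrix (Fin n) (Fin m) ℝ≥0) (μ : Fin m → Measure ℝ≥0) [∀ j, IsProbabilityMeasure (μ j)]
    {H : Finset (Fin n)} {h : ℕ} {δ : ℝ}
    (hδ : (Measure.pi μ).real {y | h < hitCount acc A Finset.univ y} ≤ δ)
    (i : Fin n) (hH : i ∈ H → 1 / 4 ≤ ∫ y, hit acc A i y ∂(Measure.pi μ))
    (hAY : ∀ j, Integrable (fun y : Fin m → ℝ≥0 => (A i j * y j : ℝ)) (Measure.pi μ)) :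
    ∑ j, ∫ y, share τ acc A H i j y * (1 - slack acc A h j y) ∂(Measure.pi μ)
      ≤ δ * (∑ j, ∫ y, share τ acc A H i j y ∂(Measure.pi μ)
        + 4 * τ * ∫ y, hit acc A i y ∂(Measure.pi μ)) := by
  set P := Measure.pi μ
  set p := ∫ y, hit acc A i y ∂P
  have hδ0 : 0 ≤ δ := measureReal_nonneg.trans hδ
  have hp0 : 0 ≤ p := integral_nonneg fun y => hit_nonneg _ _ _ _
  have iq : Integrable (hit acc A i) P :=
    integrable_of_abs_le (measurable_hit hacc.measurableSet A i) (abs_hit_le_one acc A i)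
  by_cases hi : i ∈ H
  · have h1 : ∀ j, ∫ y, share τ acc A H i j y * (1 - slack acc A h j y) ∂P
        ≤ δ * ∫ y, (A i j * y j : ℝ) ∂P := fun j => by
      refine le_trans ?_ (integral_coord_mul_one_sub_slack_le hacc.measurableSet A μ hδ j
        (fun t => (A i j * t : ℝ)) fun t => by positivity)
      refine integral_mono_of_nonneg (Eventually.of_forall fun y => ?_) ?_
        (Eventually.of_forall fun y => ?_)
      · exact mul_nonneg (share_nonneg _ _ _ _ _) (sub_nonneg.2 (slack_le_one _ _ _ _))
      · refine (hAY j).mono' (Measurable.aestronglyMeasurable ?_)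
          (Eventually.of_forall fun y => ?_)
        · have := measurable_slack hacc.measurableSet A h j
          fun_prop
        · have h0 : (0 : ℝ) ≤ A i j * y j := by positivity
          rw [Real.norm_of_nonneg (mul_nonneg h0 (sub_nonneg.2 (slack_le_one _ _ _ _)))]
          exact mul_le_of_le_one_right h0 (by linarith [slack_nonneg (acc := acc) A h j y])
      · exact mul_le_mul_of_nonneg_right (share_le _ _ _ _ _)
          (sub_nonneg.2 (slack_le_one _ _ _ _))
    refine (Finset.sum_le_sum fun j _ => h1 j).trans ?_
    rw [← Finset.mul_sum]
    refine mul_le_mul_of_nonneg_left ?_ hδ0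
    -- The left side is `𝔼 X i`; on the event that `i` is not a candidate, `X i ≤ τ`.
    have h2 : ∑ j, ∫ y, (A i j * y j : ℝ) ∂P
        ≤ ∑ j, ∫ y, share τ acc A H i j y ∂P + τ * (1 - p) := by
      rw [← integral_finsetSum _ fun j _ => hAY j,
        ← integral_finsetSum _ fun j _ => integrable_share hacc A H i j (hAY j)]
      have h3 : τ * (1 - p) = ∫ y, τ * (1 - hit acc A i y) ∂P := by
        rw [integral_const_mul, integral_sub (integrable_const _) iq]; simp [p]
      have iτ : Integrable (fun y => τ * (1 - hit acc A i y)) P :=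
        ((integrable_const _).sub iq).const_mul _
      rw [h3, ← integral_add (integrable_finsetSum _ fun j _ =>
        integrable_share hacc A H i j (hAY j)) iτ]
      refine integral_mono (integrable_finsetSum _ fun j _ => hAY j)
        ((integrable_finsetSum _ fun j _ => integrable_share hacc A H i j (hAY j)).add
          iτ) fun y => ?_
      have h4 := sum_share_add_rest hacc A H i y
      have h5 : rest τ acc A H i y = 0 := by simp [rest, hi]
      have h6 := coe_mulVec A y i
      simp only
      rw [← h6]
      rcases hit_eq_zero_or_one acc A i y with h | h
      · rw [h.2] at h4 ⊢
        have h7 : A.mulVec y i ≤ τ := not_lt.1 fun hlt => h.1 (hacc.mem_of_lt i _ hlt)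
        have h8 : (A.mulVec y i : ℝ) ≤ τ := h7
        linarith
      · rw [h.2] at h4 ⊢
        linarith
    have hp := hH hi
    have : (τ : ℝ) * (1 - p) ≤ 4 * τ * p := by nlinarith [τ.coe_nonneg]
    linarith
  · have h1 : ∀ j, ∫ y, share τ acc A H i j y * (1 - slack acc A h j y) ∂P
        ≤ δ * ∫ y, share τ acc A H i j y ∂P := fun j => by
      simp only [share, hi, if_false]
      exact integral_coord_mul_one_sub_slack_le hacc.measurableSet A μ hδ j
        (bigPart τ A i j) (bigPart_nonneg τ A i j)
    refine (Finset.sum_le_sum fun j _ => h1 j).trans ?_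
    rw [← Finset.mul_sum]
    refine mul_le_mul_of_nonneg_left ?_ hδ0
    have : 0 ≤ 4 * τ * p := by positivity
    linarith

/-- Up to a fraction `δ`, the shares are collected while the other arrivals leave room. -/
theorem le_sum_integral_share_mul_slack (hacc : IsThreshold τ acc)
    (A : Matrix (Fin n) (Fin m) ℝ≥0) (μ : Fin m → Measure ℝ≥0) [∀ j, IsProbabilityMeasure (μ j)]
    {H : Finset (Fin n)} {h : ℕ} {δ : ℝ}
    (hδ : (Measure.pi μ).real {y | h < hitCount acc A Finset.univ y} ≤ δ)
    (hH : ∀ i ∈ H, 1 / 4 ≤ ∫ y, hit acc A i y ∂(Measure.pi μ))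
    (hAY : ∀ i j, Integrable (fun y : Fin m → ℝ≥0 => (A i j * y j : ℝ)) (Measure.pi μ)) :
    (1 - δ) * ∑ i, ∑ j, ∫ y, share τ acc A H i j y ∂(Measure.pi μ)
        - 4 * δ * τ * ∑ i, ∫ y, hit acc A i y ∂(Measure.pi μ)
      ≤ ∑ i, ∑ j, ∫ y, share τ acc A H i j y * slack acc A h j y ∂(Measure.pi μ) := by
  have h1 := Finset.sum_le_sum fun i (_ : i ∈ Finset.univ) =>
    sum_integral_share_mul_one_sub_slack_le hacc A μ hδ i (hH i) (hAY i)
  have h2 : ∀ i j, ∫ y, share τ acc A H i j y * (1 - slack acc A h j y) ∂(Measure.pi μ)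
      = ∫ y, share τ acc A H i j y ∂(Measure.pi μ)
        - ∫ y, share τ acc A H i j y * slack acc A h j y ∂(Measure.pi μ) := fun i j => by
    rw [← integral_sub (integrable_share hacc A H i j (hAY i j))
      (integrable_share_mul_slack hacc A H h i j (hAY i j))]
    exact integral_congr_ae (Eventually.of_forall fun y => by simp only; ring)
  simp only [h2, Finset.sum_sub_distrib, ← Finset.mul_sum, Finset.sum_add_distrib] at h1
  linarith

/-! ### Lower bounds for the greedy reward -/

/-- The weights `c` and `d` stand for certificates that `i` is accepted: they may be nonzero for a
candidate only if it is selected, except where `A i j = 0` and the share vanishes anyway. -/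
lemma le_greedyReward (hacc : IsThreshold τ acc) (A : Matrix (Fin n) (Fin m) ℝ≥0)
    (H I : Finset (Fin n)) (r : ℕ) (y : Fin m → ℝ≥0) (c : Fin n → Fin m → ℝ) (d : Fin n → ℝ)
    (hc : ∀ i j, c i j ≤ 1) (hd : ∀ i, d i ≤ 1)
    (hsel : ∀ i, A.mulVec y i ∈ acc i → i ∉ greedySelect r I acc (A.mulVec y) →
      (∀ j, A i j ≠ 0 → c i j = 0) ∧ d i = 0) :
    ∑ i, (∑ j, share τ acc A H i j y * c i j + rest τ acc A H i y * d i)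
      ≤ greedyReward r I acc (A.mulVec y) := by
  refine Finset.sum_le_sum fun i _ => ?_
  have hsum := sum_share_add_rest hacc A H i y
  by_cases hi : i ∈ greedySelect r I acc (A.mulVec y)
  · rw [if_pos hi]
    have hx : A.mulVec y i ∈ acc i := (mem_candidates.1 (Finset.mem_filter.1 hi).1).2
    have hhit : hit acc A i y = 1 := by simp [hit, hx]
    rw [hhit, mul_one] at hsum
    rw [← hsum]
    refine add_le_add (Finset.sum_le_sum fun j _ => ?_) ?_
    · exact mul_le_of_le_one_right (share_nonneg _ _ _ _ _) (hc i j)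
    · exact mul_le_of_le_one_right (rest_nonneg _ _ _ _) (hd i)
  · rw [if_neg hi]
    refine le_of_eq ?_
    rcases hit_eq_zero_or_one acc A i y with h | h
    · have h1 : ∀ j, share τ acc A H i j y = 0 := fun j => by
        rw [← share_mul_hit hacc, h.2, mul_zero]
      have h2 : rest τ acc A H i y = 0 := by simp [rest, h.2]
      simp [h1, h2]
    · obtain ⟨h1, h2⟩ := hsel i h.1 hi
      rw [h2, mul_zero, add_zero]
      refine Finset.sum_eq_zero fun j _ => ?_
      by_cases hj : A i j = 0
      · rw [share_eq_zero_of_apply A H i j y hj, zero_mul]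
      · rw [h1 j hj, mul_zero]

/-- The arrivals other than `i` that depend on feature `j`. -/
def siblings (A : Matrix (Fin n) (Fin m) ℝ≥0) (i : Fin n) (j : Fin m) : Finset (Fin n) :=
  (Finset.univ.filter fun k => A k j ≠ 0).erase i

lemma card_siblings_lt {s : ℕ} {A : Matrix (Fin n) (Fin m) ℝ≥0}
    (hs : ∀ j, (Finset.univ.filter fun i => A i j ≠ 0).card ≤ s) {i : Fin n} {j : Fin m}
    (hij : A i j ≠ 0) : (siblings A i j).card < s :=
  lt_of_lt_of_le (Finset.card_erase_lt_of_mem (by simpa using hij)) (hs j)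

lemma mem_unaffected_or_siblings (A : Matrix (Fin n) (Fin m) ℝ≥0) (i : Fin n) (j : Fin m) (k : Fin n)
    (hk : k ≠ i) : k ∈ unaffected A j ∨ k ∈ siblings A i j := by
  by_cases h : A k j = 0
  · exact Or.inl (by simp [unaffected, h])
  · exact Or.inr (by simp [siblings, h, hk])

/-- The reward if all arrivals are considered. -/
theorem le_greedyReward_univ {r s : ℕ} (hacc : IsThreshold τ acc) (A : Matrix (Fin n) (Fin m) ℝ≥0)
    (hs : ∀ j, (Finset.univ.filter fun i => A i j ≠ 0).card ≤ s) (hsr : s ≤ r)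
    (H : Finset (Fin n)) (y : Fin m → ℝ≥0) :
    ∑ i, ∑ j, share τ acc A H i j y * slack acc A (r - s) j y
        + (∑ i, rest τ acc A H i y) * (if hitCount acc A Finset.univ y ≤ r then 1 else 0)
      ≤ greedyReward r Finset.univ acc (A.mulVec y) := by
  rw [Finset.sum_mul, ← Finset.sum_add_distrib]
  refine le_greedyReward hacc A H Finset.univ r y (fun _ j => slack acc A (r - s) j y)
    (fun _ => if hitCount acc A Finset.univ y ≤ r then 1 else 0) (fun _ _ => slack_le_one _ _ _ _)
    (fun _ => by split_ifs <;> norm_num) fun i hx hi => ⟨fun j hij => ?_, ?_⟩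
  · refine if_neg fun hle => hi ?_
    refine mem_greedySelect_of_card_lt (Finset.mem_univ i) hx (unaffected A j) (siblings A i j)
      (mem_unaffected_or_siblings A i j) ?_
    -- At most `r - s` earlier candidates are unaffected by `j`, and there are strictly fewer than
    -- `s` siblings, as `i` itself is not counted.
    have h1 := card_siblings_lt hs hij
    rw [Finset.univ_inter]
    unfold hitCount at hle
    omega
  · exact if_neg fun hle => hi (mem_greedySelect_of_card_le hx hle)

/-- The average reward if only a uniformly random set of arrivals is considered. -/
theorem le_sum_greedyReward {r h : ℕ} (hacc : IsThreshold τ acc) (A : Matrix (Fin n) (Fin m) ℝ≥0)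
    (hs : ∀ j, (Finset.univ.filter fun i => A i j ≠ 0).card ≤ r) (hh : 2 * h < r)
    (H : Finset (Fin n)) (y : Fin m → ℝ≥0) :
    2 ^ n * ∑ i, ∑ j, share τ acc A H i j y * slack acc A h j y
      ≤ 4 * ∑ I : Finset (Fin n), greedyReward r I acc (A.mulVec y) := by
  set g : Finset (Fin n) → Fin n → Fin m → ℝ := fun I i j =>
    if i ∈ I ∧ 2 * (I ∩ siblings A i j).card ≤ (siblings A i j).card then 1 else 0 with hg
  have h1 : ∀ I : Finset (Fin n), ∑ i, ∑ j, share τ acc A H i j y * (slack acc A h j y * g I i j)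
      ≤ greedyReward r I acc (A.mulVec y) := by
    intro I
    have := le_greedyReward hacc A H I r y (fun i j => slack acc A h j y * g I i j) (fun _ => 0)
      (fun i j => ?_) (fun _ => zero_le_one) fun i hx hi => ⟨fun j hij => ?_, rfl⟩
    · simpa using this
    · have h0 : 0 ≤ g I i j := by simp only [hg]; split_ifs <;> norm_num
      have h1 : g I i j ≤ 1 := by simp only [hg]; split_ifs <;> norm_num
      exact mul_le_one₀ (slack_le_one _ _ _ _) h0 h1
    · by_contra hne
      obtain ⟨hne1, hne2⟩ := mul_ne_zero_iff.1 hne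
      have hle : hitCount acc A (unaffected A j) y ≤ h := by
        by_contra hcon; exact hne1 (if_neg hcon)
      obtain ⟨hiI, hcard⟩ : i ∈ I ∧ 2 * (I ∩ siblings A i j).card ≤ (siblings A i j).card := by
        by_contra hcon; exact hne2 (if_neg hcon)
      refine hi (mem_greedySelect_of_card_lt hiI hx (unaffected A j) (siblings A i j)
        (mem_unaffected_or_siblings A i j) ?_)
      -- There are at most `r - 1` siblings, of which at most half lie in `I`; together with `h ≤ (r
      -- - 1)/2` unaffected candidates this stays below `r`.
      have h1 := card_siblings_lt hs hij
      unfold hitCount at hle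
      omega
  refine le_trans ?_ (mul_le_mul_of_nonneg_left
    (Finset.sum_le_sum fun I (_ : I ∈ Finset.univ) => h1 I) (by norm_num : (0 : ℝ) ≤ 4))
  have hcomm : ∑ I, ∑ i, ∑ j, share τ acc A H i j y * (slack acc A h j y * g I i j)
      = ∑ i, ∑ j, ∑ I, share τ acc A H i j y * (slack acc A h j y * g I i j) := by
    rw [Finset.sum_comm]
    exact Finset.sum_congr rfl fun i _ => Finset.sum_comm
  rw [hcomm, Finset.mul_sum, Finset.mul_sum]
  refine Finset.sum_le_sum fun i _ => ?_
  rw [Finset.mul_sum, Finset.mul_sum]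
  refine Finset.sum_le_sum fun j _ => ?_
  simp only [← mul_assoc]
  rw [← Finset.mul_sum]
  have h2 := card_le_four_mul_sum_subsets i (siblings A i j) (by simp [siblings])
  have h3 : 0 ≤ share τ acc A H i j y * slack acc A h j y :=
    mul_nonneg (share_nonneg _ _ _ _ _) (slack_nonneg _ _ _ _)
  have h4 := mul_le_mul_of_nonneg_left h2 h3
  simp only [hg]
  linarith

end Share

/-! ### The expected reward of threshold algorithms -/

section Reward

variable {n m : ℕ} {τ : ℝ≥0} {acc : Fin n → Set ℝ≥0}

/-- The upper bound `r τ + ∑ 𝔼 (X i - τ)⁺` for the expected reward of the prophet. -/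
def benchmark (r : ℕ) (τ : ℝ≥0) (A : Matrix (Fin n) (Fin m) ℝ≥0) (P : Measure (Fin m → ℝ≥0)) : ℝ :=
  r * τ + ∑ i, ∫ y, ((A.mulVec y i - τ : ℝ≥0) : ℝ) ∂P

lemma integrable_mulVec (A : Matrix (Fin n) (Fin m) ℝ≥0) {P : Measure (Fin m → ℝ≥0)}
    (hAY : ∀ i j, Integrable (fun y : Fin m → ℝ≥0 => (A i j * y j : ℝ)) P) (i : Fin n) :
    Integrable (fun y => (A.mulVec y i : ℝ)) P := by
  simp only [coe_mulVec]
  exact integrable_finsetSum _ fun j _ => hAY i j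

lemma integrable_mulVec_tsub (A : Matrix (Fin n) (Fin m) ℝ≥0) {P : Measure (Fin m → ℝ≥0)}
    (hAY : ∀ i j, Integrable (fun y : Fin m → ℝ≥0 => (A i j * y j : ℝ)) P) (i : Fin n) :
    Integrable (fun y => ((A.mulVec y i - τ : ℝ≥0) : ℝ)) P := by
  refine (integrable_mulVec A hAY i).mono' ?_ (Eventually.of_forall fun y => ?_)
  · exact (((measurable_mulVec_apply A i).sub_const τ).coe_nnreal_real).aestronglyMeasurable
  · rw [Real.norm_of_nonneg (NNReal.coe_nonneg _)]
    exact_mod_cast tsub_le_self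

lemma integrable_greedyReward (hacc : ∀ i, MeasurableSet (acc i)) (A : Matrix (Fin n) (Fin m) ℝ≥0)
    {P : Measure (Fin m → ℝ≥0)}
    (hAY : ∀ i j, Integrable (fun y : Fin m → ℝ≥0 => (A i j * y j : ℝ)) P) (r : ℕ)
    (I : Finset (Fin n)) : Integrable (fun y => greedyReward r I acc (A.mulVec y)) P := by
  refine (integrable_finsetSum Finset.univ fun i _ => integrable_mulVec A hAY i).mono'
    ((measurable_greedyReward r I hacc).comp (measurable_mulVec A)).aestronglyMeasurable
    (Eventually.of_forall fun y => ?_)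
  rw [Real.norm_of_nonneg (greedyReward_nonneg _ _ _ _)]
  refine Finset.sum_le_sum fun i _ => ?_
  split_ifs
  · exact le_rfl
  · positivity

/-- The expected total value of the candidates. -/
lemma sum_integral_share_add_rest (hacc : IsThreshold τ acc) (A : Matrix (Fin n) (Fin m) ℝ≥0)
    {P : Measure (Fin m → ℝ≥0)} [IsProbabilityMeasure P] (H : Finset (Fin n))
    (hAY : ∀ i j, Integrable (fun y : Fin m → ℝ≥0 => (A i j * y j : ℝ)) P) :
    ∑ i, ∑ j, ∫ y, share τ acc A H i j y ∂P + ∫ y, ∑ i, rest τ acc A H i y ∂P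
      = τ * ∑ i, ∫ y, hit acc A i y ∂P + ∑ i, ∫ y, ((A.mulVec y i - τ : ℝ≥0) : ℝ) ∂P := by
  have ir : ∀ i, Integrable (rest τ acc A H i) P := fun i =>
    integrable_of_abs_le (measurable_rest hacc A H i) (abs_rest_le A H i)
  have iq : ∀ i, Integrable (hit acc A i) P := fun i =>
    integrable_of_abs_le (measurable_hit hacc.measurableSet A i) (abs_hit_le_one acc A i)
  rw [integral_finsetSum _ fun i _ => ir i, ← Finset.sum_add_distrib, Finset.mul_sum,
    ← Finset.sum_add_distrib]
  refine Finset.sum_congr rfl fun i _ => ?_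
  have is : ∀ j, Integrable (share τ acc A H i j) P := fun j => integrable_share hacc A H i j (hAY i j)
  rw [← integral_finsetSum _ fun j _ => is j,
    ← integral_add (integrable_finsetSum _ fun j _ => is j) (ir i), ← integral_const_mul,
    ← integral_add ((iq i).const_mul _) (integrable_mulVec_tsub A hAY i)]
  refine integral_congr_ae (Eventually.of_forall fun y => ?_)
  simp only
  rw [sum_share_add_rest hacc A H i y]
  rcases hit_eq_zero_or_one acc A i y with h | h
  · have h7 : A.mulVec y i ≤ τ := not_lt.1 fun hlt => h.1 (hacc.mem_of_lt i _ hlt)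
    rw [h.2, tsub_eq_zero_of_le h7]; simp
  · rw [h.2, NNReal.coe_sub (hacc.le_of_mem i _ h.1)]; ring

lemma integrable_hitCount_sq (hacc : ∀ i, MeasurableSet (acc i)) (A : Matrix (Fin n) (Fin m) ℝ≥0)
    (P : Measure (Fin m → ℝ≥0)) [IsProbabilityMeasure P] :
    Integrable (fun y => (hitCount acc A Finset.univ y : ℝ) ^ 2) P :=
  integrable_of_abs_le (B := (n : ℝ) ^ 2)
    ((measurable_from_top.comp (measurable_hitCount hacc A _)).pow_const 2) fun y => by
      rw [abs_of_nonneg (sq_nonneg _)]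
      exact pow_le_pow_left₀ (Nat.cast_nonneg _) (by exact_mod_cast hitCount_le acc A _ y) 2

lemma integrable_hitCount (hacc : ∀ i, MeasurableSet (acc i)) (A : Matrix (Fin n) (Fin m) ℝ≥0)
    (P : Measure (Fin m → ℝ≥0)) [IsProbabilityMeasure P] :
    Integrable (fun y => (hitCount acc A Finset.univ y : ℝ)) P :=
  integrable_of_abs_le (B := (n : ℝ)) (measurable_from_top.comp (measurable_hitCount hacc A _))
    fun y => by
      rw [abs_of_nonneg (Nat.cast_nonneg _)]
      exact_mod_cast hitCount_le acc A _ y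

/-- Concentration of the number of candidates. -/
lemma measureReal_lt_hitCount_le {r s : ℕ} (hacc : ∀ i, MeasurableSet (acc i))
    (A : Matrix (Fin n) (Fin m) ℝ≥0) (μ : Fin m → Measure ℝ≥0) [∀ j, IsProbabilityMeasure (μ j)]
    (hs : ∀ j, (Finset.univ.filter fun i => A i j ≠ 0).card ≤ s) (hsr : s ≤ r) (hr : 0 < r) {u : ℝ}
    (hu : 0 < u) (hu1 : u ≤ 1) (hus : u ^ 5 * r = s)
    (hE : ∑ i, ∫ y, hit acc A i y ∂(Measure.pi μ) ≤ (1 - 2 * u) * r) :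
    (Measure.pi μ).real {y | r - s < hitCount acc A Finset.univ y} ≤ u := by
  set P := Measure.pi μ
  set E := ∑ i, ∫ y, hit acc A i y ∂P with hEdef
  have hr' : (0 : ℝ) < r := by exact_mod_cast hr
  have hE0 : 0 ≤ E := Finset.sum_nonneg fun i _ => integral_nonneg fun y => hit_nonneg _ _ _ _
  have hvar : ∫ y, ((hitCount acc A Finset.univ y : ℝ) - E) ^ 2 ∂P ≤ s * E := by
    have h1 := integral_sub_mean_sq (P := P) (B := n)
      (f := fun y => (hitCount acc A Finset.univ y : ℝ))
      (measurable_from_top.comp (measurable_hitCount hacc A Finset.univ)) fun y => by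
        rw [abs_of_nonneg (Nat.cast_nonneg _)]
        exact_mod_cast hitCount_le acc A _ y
    rw [integral_hitCount hacc A P] at h1
    rw [h1]
    linarith [integral_hitCount_sq_le hacc A μ hs]
  have hi : Integrable (fun y => ((hitCount acc A Finset.univ y : ℝ) - E) ^ 2) P := by
    have : ∀ y, ((hitCount acc A Finset.univ y : ℝ) - E) ^ 2
        = (hitCount acc A Finset.univ y : ℝ) ^ 2 - 2 * E * hitCount acc A Finset.univ y + E ^ 2 :=
      fun y => by ring
    simp only [this]
    exact ((integrable_hitCount_sq hacc A P).sub ((integrable_hitCount hacc A P).const_mul _)).add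
      (integrable_const _)
  -- Chebyshev with deviation `u r`: more than `r - s ≥ (1 - u) r` candidates exceed the mean, at
  -- most `(1 - 2u) r`, by at least `u r`. The resulting bound is even `u ^ 3`.
  have hmk := mul_meas_ge_le_integral_of_nonneg (μ := P)
    (Eventually.of_forall fun y => sq_nonneg _) hi ((u * r) ^ 2)
  have hu5 : u ^ 5 ≤ u := pow_le_of_le_one hu.le hu1 (by norm_num)
  have hsub : P.real {y | r - s < hitCount acc A Finset.univ y}
      ≤ P.real {y | (u * r) ^ 2 ≤ ((hitCount acc A Finset.univ y : ℝ) - E) ^ 2} := by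
    refine measureReal_mono fun y hy => ?_
    have hy' : r < hitCount acc A Finset.univ y + s := by
      have : r - s < hitCount acc A Finset.univ y := hy
      omega
    have hy'' : (r : ℝ) < hitCount acc A Finset.univ y + s := by exact_mod_cast hy'
    have : (s : ℝ) ≤ u * r := by rw [← hus]; exact mul_le_mul_of_nonneg_right hu5 hr'.le
    change (u * r) ^ 2 ≤ ((hitCount acc A Finset.univ y : ℝ) - E) ^ 2
    exact pow_le_pow_left₀ (by positivity) (by linarith) 2
  have h2 : (u * r) ^ 2 * P.real {y | r - s < hitCount acc A Finset.univ y} ≤ (u * r) ^ 2 * u := by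
    refine (mul_le_mul_of_nonneg_left hsub (sq_nonneg _)).trans (hmk.trans (hvar.trans ?_))
    have h3 : E ≤ r := hE.trans (by nlinarith)
    calc (s : ℝ) * E ≤ s * r := mul_le_mul_of_nonneg_left h3 (Nat.cast_nonneg _)
      _ = u ^ 2 * r ^ 2 * u ^ 3 := by rw [← hus]; ring
      _ ≤ u ^ 2 * r ^ 2 * u := mul_le_mul_of_nonneg_left
          (pow_le_of_le_one hu.le hu1 (by norm_num)) (by positivity)
      _ = _ := by ring
  exact le_of_mul_le_mul_left h2 (by positivity)

/-- The small parts that are lost because of too many candidates. -/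
lemma integral_rest_overflow_le {r s : ℕ} (hacc : IsThreshold τ acc)
    (A : Matrix (Fin n) (Fin m) ℝ≥0) (μ : Fin m → Measure ℝ≥0) [∀ j, IsProbabilityMeasure (μ j)]
    (hs : ∀ j, (Finset.univ.filter fun i => A i j ≠ 0).card ≤ s) (hr : 0 < r) {u : ℝ}
    (hu : 0 < u) (hu1 : u ≤ 1) (hus : u ^ 5 * r = s) {H : Finset (Fin n)}
    (hH : ∀ i, i ∉ H → ∫ y, hit acc A i y ∂(Measure.pi μ) ≤ 1 / 4)
    (hE : ∑ i, ∫ y, hit acc A i y ∂(Measure.pi μ) ≤ r)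
    (hδ : (Measure.pi μ).real {y | r < hitCount acc A Finset.univ y} ≤ u) :
    ∫ y, (∑ i, rest τ acc A H i y) * (1 - if hitCount acc A Finset.univ y ≤ r then 1 else 0)
        ∂(Measure.pi μ)
      ≤ u * ∫ y, ∑ i, rest τ acc A H i y ∂(Measure.pi μ) + 21 * u * (τ * r) := by
  set P := Measure.pi μ
  set F : (Fin m → ℝ≥0) → ℝ := fun y => ∑ i, rest τ acc A H i y with hF
  set EF := ∫ y, F y ∂P
  set b : (Fin m → ℝ≥0) → ℝ := fun y => 1 - if hitCount acc A Finset.univ y ≤ r then 1 else 0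
    with hb
  have hr' : (0 : ℝ) < r := by exact_mod_cast hr
  have hFm : Measurable F := Finset.measurable_sum _ fun i _ => measurable_rest hacc A H i
  have hF0 : ∀ y, 0 ≤ F y := fun y => Finset.sum_nonneg fun i _ => rest_nonneg _ _ _ _
  have hFb : ∀ y, F y ≤ n * (m * τ) := fun y => by
    have := Finset.sum_le_card_nsmul Finset.univ (fun i => rest τ acc A H i y) (m * τ)
      fun i _ => rest_le A H i y
    simpa using this
  have hEF0 : 0 ≤ EF := integral_nonneg hF0
  have hb01 : ∀ y, b y = 0 ∨ b y = 1 := fun y => by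
    by_cases h : hitCount acc A Finset.univ y ≤ r <;> simp [hb, h]
  have hbm : Measurable b := measurable_const.sub (Measurable.ite
    (measurableSet_le (measurable_hitCount hacc.measurableSet A _) measurable_const)
    measurable_const measurable_const)
  have hbabs : ∀ y, |b y| ≤ 1 := fun y => by rcases hb01 y with h | h <;> simp [h]
  have hbint : ∫ y, b y ∂P ≤ u := by
    have h1 : b = ({y | r < hitCount acc A Finset.univ y} : Set (Fin m → ℝ≥0)).indicator 1 := by
      ext y
      by_cases h : hitCount acc A Finset.univ y ≤ r
      · simp [hb, h]
      · simp [hb, h, not_le.1 h]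
    rw [h1, integral_indicator_one
      (measurableSet_lt measurable_const (measurable_hitCount hacc.measurableSet A _))]
    exact hδ
  rcases eq_or_lt_of_le (zero_le (a := τ)) with h0 | h0
  · have hz : ∀ y, F y = 0 := fun y => by
      have := hFb y
      rw [← h0] at this
      have h1 := hF0 y
      simp only [NNReal.coe_zero, mul_zero] at this
      linarith
    have h1 : ∀ y, F y * b y = 0 := fun y => by rw [hz y, zero_mul]
    calc ∫ y, F y * b y ∂P = 0 := by simp only [h1]; simp
      _ ≤ _ := by positivity
  · have hτ : (0 : ℝ) < τ := h0
    have iF2 : Integrable (fun y => (F y - EF) ^ 2) P := by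
      refine integrable_of_abs_le (B := (n * (m * τ) + EF) ^ 2)
        ((hFm.sub_const _).pow_const 2) fun y => ?_
      rw [abs_pow]
      refine pow_le_pow_left₀ (abs_nonneg _) ((abs_sub _ _).trans ?_) 2
      rw [abs_of_nonneg (hF0 y), abs_of_nonneg hEF0]
      linarith [hFb y]
    have ib : Integrable b P := integrable_of_abs_le hbm hbabs
    have iFb : Integrable (fun y => F y * b y) P :=
      integrable_of_abs_le (B := n * (m * τ)) (hFm.mul hbm) fun y => by
        rw [abs_mul, abs_of_nonneg (hF0 y)]
        exact (mul_le_of_le_one_right (hF0 y) (hbabs y)).trans (hFb y)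
    have hvar : ∫ y, (F y - EF) ^ 2 ∂P ≤ s * (40 * τ ^ 2 * r) :=
      (variance_sum_rest_le hacc A μ hs hH).trans
        (mul_le_mul_of_nonneg_left (mul_le_mul_of_nonneg_left hE (by positivity))
          (Nat.cast_nonneg _))
    -- On the overflow event, `2τr (F - EF) ≤ (τr)² + (F - EF)²`: Cauchy–Schwarz in linearized form,
    -- with weight `τr` matching the scale of the benchmark.
    have h1 : 2 * (τ * r) * ∫ y, F y * b y ∂P
        ≤ (2 * (τ * r) * EF + (τ * r) ^ 2) * ∫ y, b y ∂P + ∫ y, (F y - EF) ^ 2 ∂P := by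
      rw [← integral_const_mul, ← integral_const_mul, ← integral_add (ib.const_mul _) iF2]
      refine integral_mono (iFb.const_mul _) ((ib.const_mul _).add iF2) fun y => ?_
      simp only
      rcases hb01 y with h | h
      · rw [h]; nlinarith [sq_nonneg (F y - EF)]
      · rw [h]; nlinarith [sq_nonneg (F y - EF - τ * r)]
    have h2 : (2 * (τ * r) * EF + (τ * r) ^ 2) * ∫ y, b y ∂P
        ≤ (2 * (τ * r) * EF + (τ * r) ^ 2) * u :=
      mul_le_mul_of_nonneg_left hbint (by positivity)
    have h3 : (s : ℝ) * (40 * τ ^ 2 * r) ≤ 40 * u * (τ * r) ^ 2 := by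
      rw [← hus]
      have : u ^ 5 ≤ u := pow_le_of_le_one hu.le hu1 (by norm_num)
      calc u ^ 5 * r * (40 * τ ^ 2 * r) = u ^ 5 * (40 * (τ * r) ^ 2) := by ring
        _ ≤ u * (40 * (τ * r) ^ 2) := mul_le_mul_of_nonneg_right this (by positivity)
        _ = _ := by ring
    have h4 : 2 * (τ * r) * ∫ y, F y * b y ∂P
        ≤ 2 * (τ * r) * (u * EF + 21 * u * (τ * r)) := by
      have : 0 ≤ u * (τ * r : ℝ) ^ 2 := by positivity
      linarith
    exact le_of_mul_le_mul_left h4 (by positivity)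

/-- The reward if columns are sparse compared to `r`. -/
theorem benchmark_le_of_sparse {r s : ℕ} (hacc : IsThreshold τ acc)
    (A : Matrix (Fin n) (Fin m) ℝ≥0) (μ : Fin m → Measure ℝ≥0) [∀ j, IsProbabilityMeasure (μ j)]
    (hs : ∀ j, (Finset.univ.filter fun i => A i j ≠ 0).card ≤ s) (hs1 : 1 ≤ s) (hsr : s ≤ r) {u : ℝ}
    (hu : 0 < u) (hu1 : u ≤ 1) (hus : u ^ 5 * r = s)
    (hAY : ∀ i j, Integrable (fun y : Fin m → ℝ≥0 => (A i j * y j : ℝ)) (Measure.pi μ))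
    (hE : ∑ i, ∫ y, hit acc A i y ∂(Measure.pi μ) ≤ (1 - 2 * u) * r)
    (hlow : τ = 0 ∨ (1 - 2 * u) * r ≤ ∑ i, ∫ y, hit acc A i y ∂(Measure.pi μ) + 1) :
    (1 - 29 * u) * benchmark r τ A (Measure.pi μ)
      ≤ ∫ y, greedyReward r Finset.univ acc (A.mulVec y) ∂(Measure.pi μ) := by
  classical
  set P := Measure.pi μ
  set E := ∑ i, ∫ y, hit acc A i y ∂P with hEdef
  have hr : 0 < r := by omega
  have hr' : (0 : ℝ) < r := by exact_mod_cast hr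
  have hE0 : 0 ≤ E := Finset.sum_nonneg fun i _ => integral_nonneg fun y => hit_nonneg _ _ _ _
  have hEr : E ≤ r := hE.trans (by nlinarith)
  have hτ : (0 : ℝ) ≤ τ := τ.coe_nonneg
  set H : Finset (Fin n) := Finset.univ.filter fun i => 1 / 4 ≤ ∫ y, hit acc A i y ∂P
  have hH1 : ∀ i ∈ H, 1 / 4 ≤ ∫ y, hit acc A i y ∂P := fun i hi => (Finset.mem_filter.1 hi).2
  have hH2 : ∀ i, i ∉ H → ∫ y, hit acc A i y ∂P ≤ 1 / 4 := fun i hi => by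
    by_contra hcon
    exact hi (Finset.mem_filter.2 ⟨Finset.mem_univ _, (not_le.1 hcon).le⟩)
  have hδ := measureReal_lt_hitCount_le hacc.measurableSet A μ hs hsr hr hu hu1 hus hE
  have hδ' : P.real {y | r < hitCount acc A Finset.univ y} ≤ u := by
    refine le_trans (measureReal_mono fun y hy => ?_) hδ
    have : r < hitCount acc A Finset.univ y := hy
    change r - s < _
    omega
  have h1 := le_sum_integral_share_mul_slack hacc A μ hδ hH1 hAY
  have h2 := integral_rest_overflow_le hacc A μ hs hr hu hu1 hus hH2 hEr hδ'
  have h3 := sum_integral_share_add_rest hacc A H hAY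
  set S := ∑ i, ∑ j, ∫ y, share τ acc A H i j y ∂P
  set EF := ∫ y, ∑ i, rest τ acc A H i y ∂P
  set V := ∑ i, ∫ y, ((A.mulVec y i - τ : ℝ≥0) : ℝ) ∂P with hV
  have hV0 : 0 ≤ V := Finset.sum_nonneg fun i _ => integral_nonneg fun y => NNReal.coe_nonneg _
  have iF : Integrable (fun y => ∑ i, rest τ acc A H i y) P :=
    integrable_finsetSum _ fun i _ =>
      integrable_of_abs_le (measurable_rest hacc A H i) (abs_rest_le A H i)
  set b : (Fin m → ℝ≥0) → ℝ := fun y => if hitCount acc A Finset.univ y ≤ r then 1 else 0 with hb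
  have hbm : Measurable b := Measurable.ite
    (measurableSet_le (measurable_hitCount hacc.measurableSet A _) measurable_const)
    measurable_const measurable_const
  have iFb : Integrable (fun y => (∑ i, rest τ acc A H i y) * b y) P := by
    refine iF.mono' ((Finset.measurable_sum _ fun i _ => measurable_rest hacc A H i).mul
      hbm).aestronglyMeasurable (Eventually.of_forall fun y => ?_)
    have h0 : 0 ≤ ∑ i, rest τ acc A H i y := Finset.sum_nonneg fun i _ => rest_nonneg _ _ _ _
    by_cases h : hitCount acc A Finset.univ y ≤ r
    · simp [hb, h, abs_of_nonneg h0]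
    · simp [hb, h, h0]
  have h4 : ∫ y, (∑ i, rest τ acc A H i y) * (1 - b y) ∂P
      = EF - ∫ y, (∑ i, rest τ acc A H i y) * b y ∂P := by
    rw [← integral_sub iF iFb]
    exact integral_congr_ae (Eventually.of_forall fun y => by simp only; ring)
  have iss : ∀ i j, Integrable (fun y => share τ acc A H i j y * slack acc A (r - s) j y) P :=
    fun i j => integrable_share_mul_slack hacc A H (r - s) i j (hAY i j)
  have h5 : ∑ i, ∑ j, ∫ y, share τ acc A H i j y * slack acc A (r - s) j y ∂P
      + ∫ y, (∑ i, rest τ acc A H i y) * b y ∂P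
      ≤ ∫ y, greedyReward r Finset.univ acc (A.mulVec y) ∂P := by
    have h6 : ∑ i, ∑ j, ∫ y, share τ acc A H i j y * slack acc A (r - s) j y ∂P
        = ∫ y, ∑ i, ∑ j, share τ acc A H i j y * slack acc A (r - s) j y ∂P := by
      rw [integral_finsetSum _ fun i _ => integrable_finsetSum _ fun j _ => iss i j]
      exact Finset.sum_congr rfl fun i _ => (integral_finsetSum _ fun j _ => iss i j).symm
    have iS := integrable_finsetSum Finset.univ fun i _ =>
      integrable_finsetSum Finset.univ fun j _ => iss i j
    rw [h6, ← integral_add iS iFb]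
    exact integral_mono (iS.add iFb) (integrable_greedyReward hacc.measurableSet A hAY r _)
      fun y => le_greedyReward_univ hacc A hs hsr H y
  change ∫ y, (∑ i, rest τ acc A H i y) * (1 - b y) ∂P ≤ _ at h2
  rw [h4] at h2
  -- The possible shortfall of `1` in the expected count is absorbed by `1 ≤ s = u ^ 5 * r ≤ u * r`.
  -- This is where `s ≥ 1` is needed.
  have hlow' : τ * ((1 - 3 * u) * r) ≤ τ * E := by
    rcases hlow with h | h
    · simp [h]
    · have hs1' : (1 : ℝ) ≤ s := by exact_mod_cast hs1
      have hu5 : u ^ 5 ≤ u := pow_le_of_le_one hu.le hu1 (by norm_num)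
      have : (s : ℝ) ≤ u * r := by rw [← hus]; exact mul_le_mul_of_nonneg_right hu5 hr'.le
      exact mul_le_mul_of_nonneg_left (by linarith) hτ
  have hτE : u * (τ * E) ≤ u * (τ * r) :=
    mul_le_mul_of_nonneg_left (mul_le_mul_of_nonneg_left hEr hτ) hu.le
  have h7 : (1 - u) * (τ * ((1 - 3 * u) * r)) ≤ (1 - u) * (τ * E) :=
    mul_le_mul_of_nonneg_left hlow' (by linarith)
  have h8 : 0 ≤ u * V := by positivity
  have h9 : 0 ≤ u ^ 2 * (τ * r) := by positivity
  have h10 : (1 - u) * S + (1 - u) * EF = (1 - u) * (τ * E) + (1 - u) * V := by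
    rw [← mul_add, h3, mul_add]
  have hbm' : benchmark r τ A P = r * τ + V := rfl
  rw [hbm']
  -- The losses relative to `τ r` are `u` from the overflow probability, `3u` from the expected
  -- count, `4u` from the likely candidates and `21u` from the rest: `29u` in total.
  nlinarith

lemma apply_le_greedyReward_singleton {r : ℕ} (hr : 0 < r) (i : Fin n) (x : Fin n → ℝ≥0) :
    (x i : ℝ) ≤ greedyReward r {i} (fun _ => Set.univ) x := by
  have hi : i ∈ greedySelect r {i} (fun _ => Set.univ) x := by
    refine mem_greedySelect_of_card_lt (Finset.mem_singleton_self i) (Set.mem_univ _) ∅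
      (Finset.univ.erase i) (fun k hk => Or.inr (by simp [hk])) ?_
    simpa [candidates] using hr
  have h := Finset.single_le_sum (s := Finset.univ)
    (f := fun k => if k ∈ greedySelect r {i} (fun _ => Set.univ) x then (x k : ℝ) else 0)
    (fun k _ => by split_ifs <;> simp) (Finset.mem_univ i)
  simp only [if_pos hi] at h
  exact h

/-- A constant fraction of the benchmark is always achievable. -/
theorem exists_benchmark_le {r : ℕ} (hacc : IsThreshold τ acc)
    (A : Matrix (Fin n) (Fin m) ℝ≥0) (μ : Fin m → Measure ℝ≥0) [∀ j, IsProbabilityMeasure (μ j)]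
    (hs : ∀ j, (Finset.univ.filter fun i => A i j ≠ 0).card ≤ r) (hr : 0 < r)
    (hAY : ∀ i j, Integrable (fun y : Fin m → ℝ≥0 => (A i j * y j : ℝ)) (Measure.pi μ))
    (hE : ∑ i, ∫ y, hit acc A i y ∂(Measure.pi μ) ≤ r / 8)
    (hlow : τ = 0 ∨ (r / 8 : ℝ) ≤ ∑ i, ∫ y, hit acc A i y ∂(Measure.pi μ) ∨
      ∃ i₀, (r / 8 : ℝ) ≤ ∑ i, ∫ y, hit acc A i y ∂(Measure.pi μ)
        + (Measure.pi μ).real {y | A.mulVec y i₀ = τ}) :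
    ∃ (I : Finset (Fin n)) (acc' : Fin n → Set ℝ≥0), (∀ i, MeasurableSet (acc' i)) ∧
      benchmark r τ A (Measure.pi μ)
        ≤ 60 * ∫ y, greedyReward r I acc' (A.mulVec y) ∂(Measure.pi μ) := by
  classical
  set P := Measure.pi μ
  set E := ∑ i, ∫ y, hit acc A i y ∂P with hEdef
  -- Arguing by contradiction bounds the rewards of all greedy variants by the same `M`, so that the
  -- different estimates below may each use a different algorithm.
  by_contra! hcon
  set M := benchmark r τ A P / 60 with hM
  have hle : ∀ (I : Finset (Fin n)) (acc' : Fin n → Set ℝ≥0), (∀ i, MeasurableSet (acc' i)) →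
      ∫ y, greedyReward r I acc' (A.mulVec y) ∂P < M := fun I acc' h => by
    have := hcon I acc' h
    rw [hM]; linarith
  have hr' : (0 : ℝ) < r := by exact_mod_cast hr
  have hE0 : 0 ≤ E := Finset.sum_nonneg fun i _ => integral_nonneg fun y => hit_nonneg _ _ _ _
  have hτ : (0 : ℝ) ≤ τ := τ.coe_nonneg
  have hMpos : 0 < M := (integral_nonneg fun y => greedyReward_nonneg _ _ _ _).trans_lt
    (hle Finset.univ acc hacc.measurableSet)
  set H : Finset (Fin n) := Finset.univ.filter fun i => 1 / 4 ≤ ∫ y, hit acc A i y ∂P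
  have hH1 : ∀ i ∈ H, 1 / 4 ≤ ∫ y, hit acc A i y ∂P := fun i hi => (Finset.mem_filter.1 hi).2
  have hH2 : ∀ i, i ∉ H → ∫ y, hit acc A i y ∂P ≤ 1 / 4 := fun i hi => by
    by_contra hcon
    exact hi (Finset.mem_filter.2 ⟨Finset.mem_univ _, (not_le.1 hcon).le⟩)
  -- many candidates are collected
  have hτE : τ * E * (23 / 32) ≤ M := by
    refine le_trans ?_ (hle Finset.univ acc hacc.measurableSet).le
    -- `N - N² / (4r)` is a minorant of `min N r` whose expectation needs only two moments; its
    -- bound by `r` is `(N - 2r)² ≥ 0`.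
    have h1 : ∫ y, τ * ((hitCount acc A Finset.univ y : ℝ)
        - (1 / (4 * r)) * (hitCount acc A Finset.univ y : ℝ) ^ 2) ∂P
        ≤ ∫ y, greedyReward r Finset.univ acc (A.mulVec y) ∂P := by
      refine integral_mono (((integrable_hitCount hacc.measurableSet A P).sub
        ((integrable_hitCount_sq hacc.measurableSet A P).const_mul _)).const_mul _)
        (integrable_greedyReward hacc.measurableSet A hAY r _) fun y => ?_
      refine le_trans ?_ (mul_min_le_greedyReward (r := r) Finset.univ acc (A.mulVec y) τ hτ
        fun i hi => by exact_mod_cast hacc.le_of_mem i _ hi)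
      refine mul_le_mul_of_nonneg_left ?_ hτ
      change (hitCount acc A Finset.univ y : ℝ)
        - (1 / (4 * r)) * (hitCount acc A Finset.univ y : ℝ) ^ 2
        ≤ min (hitCount acc A Finset.univ y : ℝ) r
      set N : ℝ := (hitCount acc A Finset.univ y : ℝ)
      refine le_min ?_ ?_
      · have : 0 ≤ (1 / (4 * r) : ℝ) * N ^ 2 := by positivity
        linarith
      · have : (r : ℝ) - N + (1 / (4 * r)) * N ^ 2 = (N - 2 * r) ^ 2 / (4 * r) := by
          field_simp; ring
        have h2 : 0 ≤ (N - 2 * r) ^ 2 / (4 * r) := by positivity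
        linarith
    refine le_trans ?_ h1
    rw [integral_const_mul, integral_sub (integrable_hitCount hacc.measurableSet A P)
      ((integrable_hitCount_sq hacc.measurableSet A P).const_mul _), integral_const_mul,
      integral_hitCount hacc.measurableSet A P, mul_assoc]
    refine mul_le_mul_of_nonneg_left ?_ hτ
    have h2 := integral_hitCount_sq_le hacc.measurableSet A μ hs
    change E * (23 / 32) ≤ E - _
    -- The second moment is at most `r E + E²`, with `E ≤ r / 8`. This leaves the fraction `1 - 9/32
    -- = 23/32`.
    have h3 : ∫ y, (hitCount acc A Finset.univ y : ℝ) ^ 2 ∂P ≤ E * (9 / 8 * r) :=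
      h2.trans (by change (r : ℝ) * E + E ^ 2 ≤ _; nlinarith)
    have h4 : (1 / (4 * r) : ℝ) * ∫ y, (hitCount acc A Finset.univ y : ℝ) ^ 2 ∂P
        ≤ (1 / (4 * r) : ℝ) * (E * (9 / 8 * r)) := mul_le_mul_of_nonneg_left h3 (by positivity)
    have h5 : (1 / (4 * r) : ℝ) * (E * (9 / 8 * r)) = E * (9 / 32) := by field_simp; ring
    linarith
  -- the shares are collected on average over the random sets
  set h := (r - 1) / 2 with hh
  -- Markov suffices: the mean is at most `r / 8`, and exceeding `h` means reaching `r / 2`.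
  have hδ : P.real {y | h < hitCount acc A Finset.univ y} ≤ 1 / 4 := by
    have hmk := mul_meas_ge_le_integral_of_nonneg (μ := P)
      (Eventually.of_forall fun y => Nat.cast_nonneg _)
      (integrable_hitCount hacc.measurableSet A P) (r / 2)
    rw [integral_hitCount hacc.measurableSet A P] at hmk
    have hsub : P.real {y | h < hitCount acc A Finset.univ y}
        ≤ P.real {y | (r / 2 : ℝ) ≤ hitCount acc A Finset.univ y} := by
      refine measureReal_mono fun y hy => ?_
      have h1 : h < hitCount acc A Finset.univ y := hy
      have h2 : r ≤ 2 * hitCount acc A Finset.univ y := by omega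
      have h3 : (r : ℝ) ≤ 2 * hitCount acc A Finset.univ y := by exact_mod_cast h2
      change (r / 2 : ℝ) ≤ hitCount acc A Finset.univ y
      linarith
    have h1 : (r / 2 : ℝ) * P.real {y | h < hitCount acc A Finset.univ y} ≤ r / 2 * (1 / 4) :=
      (mul_le_mul_of_nonneg_left hsub (by positivity)).trans (hmk.trans (hE.trans (by linarith)))
    exact le_of_mul_le_mul_left h1 (by positivity)
  have h1 := le_sum_integral_share_mul_slack hacc A μ hδ hH1 hAY
  have iss : ∀ i j, Integrable (fun y => share τ acc A H i j y * slack acc A h j y) P :=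
    fun i j => integrable_share_mul_slack hacc A H h i j (hAY i j)
  have h2 : ∑ i, ∑ j, ∫ y, share τ acc A H i j y * slack acc A h j y ∂P ≤ 4 * M := by
    have h6 : ∑ i, ∑ j, ∫ y, share τ acc A H i j y * slack acc A h j y ∂P
        = ∫ y, ∑ i, ∑ j, share τ acc A H i j y * slack acc A h j y ∂P := by
      rw [integral_finsetSum _ fun i _ => integrable_finsetSum _ fun j _ => iss i j]
      exact Finset.sum_congr rfl fun i _ => (integral_finsetSum _ fun j _ => iss i j).symm
    have iS := integrable_finsetSum Finset.univ fun i _ =>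
      integrable_finsetSum Finset.univ fun j _ => iss i j
    have iR : ∀ I : Finset (Fin n), Integrable (fun y => greedyReward r I acc (A.mulVec y)) P :=
      fun I => integrable_greedyReward hacc.measurableSet A hAY r I
    have h7 := integral_mono (iS.const_mul (2 ^ n))
      ((integrable_finsetSum Finset.univ fun I _ => iR I).const_mul 4)
      fun y => le_sum_greedyReward (r := r) (h := h) hacc A hs (by omega) H y
    rw [integral_const_mul, integral_const_mul, integral_finsetSum _ fun I _ => iR I, ← h6] at h7
    have h8 : ∑ I : Finset (Fin n), ∫ y, greedyReward r I acc (A.mulVec y) ∂P ≤ 2 ^ n * M := by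
      have := Finset.sum_le_card_nsmul Finset.univ
        (fun I : Finset (Fin n) => ∫ y, greedyReward r I acc (A.mulVec y) ∂P) M
        fun I _ => (hle I acc hacc.measurableSet).le
      simpa using this
    have h9 : (2 : ℝ) ^ n * ∑ i, ∑ j, ∫ y, share τ acc A H i j y * slack acc A h j y ∂P
        ≤ 2 ^ n * (4 * M) := by linarith
    exact le_of_mul_le_mul_left h9 (by positivity)
  have h3 := sum_integral_share_add_rest hacc A H hAY
  have h4 : ∫ y, ∑ i, rest τ acc A H i y ∂P ≤ 21 * (τ * E) := by
    rw [integral_finsetSum _ fun i _ =>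
      integrable_of_abs_le (measurable_rest hacc A H i) (abs_rest_le A H i), hEdef,
      ← mul_assoc, Finset.mul_sum]
    exact Finset.sum_le_sum fun i _ => integral_rest_le hacc A μ hH2 i
  -- When `r / 8` is small, the atom missing from the expected count is not negligible. It is paid
  -- for by the algorithm that accepts `i₀` unconditionally, whose reward is at least `τ` times the
  -- mass of the atom.
  have h5 : τ * r ≤ 8 * (τ * E + M) := by
    rcases hlow with h | h | ⟨i₀, h⟩
    · have : 0 ≤ τ * E := by positivity
      rw [h] at this ⊢
      simp only [NNReal.coe_zero, zero_mul] at this ⊢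
      linarith
    · nlinarith
    · have h6 : τ * P.real {y | A.mulVec y i₀ = τ} ≤ M := by
        refine le_trans ?_ (hle {i₀} (fun _ => Set.univ) fun _ => MeasurableSet.univ).le
        have h7 := mul_meas_ge_le_integral_of_nonneg (μ := P)
          (Eventually.of_forall fun y => NNReal.coe_nonneg _) (integrable_mulVec A hAY i₀) τ
        refine le_trans (mul_le_mul_of_nonneg_left (measureReal_mono fun y hy => ?_) hτ)
          (h7.trans (integral_mono (integrable_mulVec A hAY i₀)
            (integrable_greedyReward (fun _ => MeasurableSet.univ) A hAY r _)
            fun y => apply_le_greedyReward_singleton hr i₀ _))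
        have hy' : A.mulVec y i₀ = τ := hy
        simp [hy']
      nlinarith
  set S := ∑ i, ∑ j, ∫ y, share τ acc A H i j y ∂P
  set V := ∑ i, ∫ y, ((A.mulVec y i - τ : ℝ≥0) : ℝ) ∂P with hV
  have hbm' : benchmark r τ A P = r * τ + V := rfl
  have hτE0 : 0 ≤ τ * E := by positivity
  have h60 : r * τ + V = 60 * M := by rw [hM, hbm']; ring
  -- The shares are at most `(4M + τE) / (3/4)` and the rest at most `21τE`. With `h5` and `τE ≤
  -- (32/23) M`, the benchmark is below `55 M`, contradicting its being `60 M` with `M > 0`.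
  linarith

end Reward

/-! ### The approximation ratio -/

lemma expectedOpt_le_benchmark {n m : ℕ} (r : ℕ) (τ : ℝ≥0) (A : Matrix (Fin n) (Fin m) ℝ≥0)
    (μ : Fin m → Measure ℝ≥0) [∀ j, IsProbabilityMeasure (μ j)]
    (hAY : ∀ i j, Integrable (fun y : Fin m → ℝ≥0 => (A i j * y j : ℝ)) (Measure.pi μ)) :
    expectedOpt r A μ ≤ ENNReal.ofReal (benchmark r τ A (Measure.pi μ)) := by
  have iV : ∀ i, Integrable (fun y => ((A.mulVec y i - τ : ℝ≥0) : ℝ)) (Measure.pi μ) :=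
    integrable_mulVec_tsub A hAY
  have h1 : benchmark r τ A (Measure.pi μ)
      = ∫ y, (r * τ + ∑ i, ((A.mulVec y i - τ : ℝ≥0) : ℝ)) ∂(Measure.pi μ) := by
    rw [integral_add (integrable_const _) (integrable_finsetSum _ fun i _ => iV i),
      integral_finsetSum _ fun i _ => iV i]
    simp [benchmark]
  have i1 : Integrable (fun y => (r * τ + ∑ i, ((A.mulVec y i - τ : ℝ≥0) : ℝ))) (Measure.pi μ) :=
    (integrable_const _).add (integrable_finsetSum _ fun i _ => iV i)
  rw [h1, ofReal_integral_eq_lintegral_ofReal i1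
    (Eventually.of_forall fun y => by positivity)]
  refine lintegral_mono fun y => ?_
  have h2 : (r * τ + ∑ i, ((A.mulVec y i - τ : ℝ≥0) : ℝ) : ℝ)
      = ((r * τ + ∑ i, (A.mulVec y i - τ) : ℝ≥0) : ℝ) := by push_cast; rfl
  rw [h2, ENNReal.ofReal_coe_nnreal]
  exact ENNReal.coe_le_coe.2 (opt_le_threshold r τ (A.mulVec y))

lemma le_expectedReward_greedy {n m r : ℕ} {τ : ℝ≥0} {acc : Fin n → Set ℝ≥0}
    (hacc : ∀ i, MeasurableSet (acc i)) (I : Finset (Fin n)) (A : Matrix (Fin n) (Fin m) ℝ≥0)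
    (μ : Fin m → Measure ℝ≥0) [∀ j, IsProbabilityMeasure (μ j)]
    (hAY : ∀ i j, Integrable (fun y : Fin m → ℝ≥0 => (A i j * y j : ℝ)) (Measure.pi μ)) {κ : ℝ}
    (hκ : 0 ≤ κ) (h : κ * benchmark r τ A (Measure.pi μ)
      ≤ ∫ y, greedyReward r I acc (A.mulVec y) ∂(Measure.pi μ)) :
    ENNReal.ofReal κ * expectedOpt r A μ ≤ expectedReward (greedy r I acc hacc) A μ := by
  rw [expectedReward_greedy, ← ofReal_integral_eq_lintegral_ofReal
    (integrable_greedyReward hacc A hAY r I)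
    (Eventually.of_forall fun y => greedyReward_nonneg _ _ _ _)]
  refine (mul_le_mul_right (expectedOpt_le_benchmark r τ A μ hAY) _).trans ?_
  rw [← ENNReal.ofReal_mul hκ]
  exact ENNReal.ofReal_le_ofReal h

/-- An infinite expected reward is collected by accepting a single arrival. -/
lemma exists_expectedReward_eq_top {n m r : ℕ} (hr : 0 < r) (A : Matrix (Fin n) (Fin m) ℝ≥0)
    (μ : Fin m → Measure ℝ≥0) [∀ j, IsProbabilityMeasure (μ j)] (i : Fin n) (j : Fin m)
    (hAY : ¬ Integrable (fun y : Fin m → ℝ≥0 => (A i j * y j : ℝ)) (Measure.pi μ)) :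
    ∃ alg : OnlineAlgorithm n r, expectedReward alg A μ = ∞ := by
  refine ⟨greedy r {i} (fun _ => Set.univ) fun _ => MeasurableSet.univ, ?_⟩
  rw [expectedReward_greedy, eq_top_iff]
  have hmeas : Measurable fun y : Fin m → ℝ≥0 => (A i j * y j : ℝ) := by fun_prop
  have h : ∫⁻ y, ENNReal.ofReal (A i j * y j : ℝ) ∂(Measure.pi μ) = ∞ := by
    by_contra hne
    exact hAY ((lintegral_ofReal_ne_top_iff_integrable hmeas.aestronglyMeasurable
      (Eventually.of_forall fun y => by positivity)).1 hne)
  rw [← h]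
  refine lintegral_mono fun y => ENNReal.ofReal_le_ofReal ?_
  refine le_trans ?_ (apply_le_greedyReward_singleton hr i (A.mulVec y))
  rw [coe_mulVec]
  exact Finset.single_le_sum (f := fun k => (A i k * y k : ℝ)) (fun k _ => by positivity)
    (Finset.mem_univ j)

lemma card_support_le_of_colSparsity_le {n m s : ℕ} {A : Matrix (Fin n) (Fin m) ℝ≥0}
    (h : colSparsity A ≤ s) (j : Fin m) : (Finset.univ.filter fun i => A i j ≠ 0).card ≤ s :=
  (Finset.le_sup (f := fun j : Fin m => (Finset.univ.filter fun i : Fin n => A i j ≠ 0).card)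
    (Finset.mem_univ j)).trans h

lemma expectedOpt_eq_zero {n m r : ℕ} {A : Matrix (Fin n) (Fin m) ℝ≥0}
    (μ : Fin m → Measure ℝ≥0) (h : colSparsity A ≤ 0) : expectedOpt r A μ = 0 := by
  have hA : ∀ i j, A i j = 0 := fun i j => by
    have h1 := card_support_le_of_colSparsity_le h j
    by_contra hne
    have h2 : i ∈ Finset.univ.filter fun i => A i j ≠ 0 := by simpa using hne
    rw [Nat.le_zero, Finset.card_eq_zero] at h1
    simp [h1] at h2
  have hopt : ∀ y, opt r (A.mulVec y) = 0 := fun y => by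
    have h1 := opt_le_threshold r 0 (A.mulVec y)
    have h2 : ∀ i, A.mulVec y i = 0 := fun i => by simp [Matrix.mulVec, dotProduct, hA]
    simpa [h2] using h1
  simp [expectedOpt, hopt]

lemma exists_reward_of_sparse {n m r s : ℕ} (A : Matrix (Fin n) (Fin m) ℝ≥0)
    (μ : Fin m → Measure ℝ≥0) [∀ j, IsProbabilityMeasure (μ j)]
    (hs : ∀ j, (Finset.univ.filter fun i => A i j ≠ 0).card ≤ s) (hs1 : 1 ≤ s) (hsr : s ≤ r) {u : ℝ}
    (hu : 0 < u) (hu1 : u ≤ 1 / 100) (hus : u ^ 5 * r = s)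
    (hAY : ∀ i j, Integrable (fun y : Fin m → ℝ≥0 => (A i j * y j : ℝ)) (Measure.pi μ)) {κ : ℝ}
    (hκ : 0 ≤ κ) (hκu : κ ≤ 1 - 29 * u) :
    ∃ alg : OnlineAlgorithm n r, ENNReal.ofReal κ * expectedOpt r A μ ≤ expectedReward alg A μ := by
  have hr' : (0 : ℝ) < r := by exact_mod_cast (by omega : 0 < r)
  obtain ⟨τ, D, hE, hlow⟩ := exists_threshold (P := Measure.pi μ) (fun i y => A.mulVec y i)
    (measurable_mulVec_apply A) ((1 - 2 * u) * r) (mul_pos (by linarith) hr')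
  have hacc := isThreshold_thresholdRegion τ D
  simp only [← integral_hit hacc.measurableSet A] at hE hlow
  refine ⟨greedy r Finset.univ _ hacc.measurableSet,
    le_expectedReward_greedy (τ := τ) hacc.measurableSet _ A μ hAY hκ (le_trans ?_
      (benchmark_le_of_sparse hacc A μ hs hs1 hsr hu (by linarith) hus hAY hE ?_))⟩
  · refine mul_le_mul_of_nonneg_right hκu ?_
    exact add_nonneg (by positivity)
      (Finset.sum_nonneg fun i _ => integral_nonneg fun y => NNReal.coe_nonneg _)
  · rcases hlow with h | h | ⟨i₀, h⟩
    · exact Or.inl h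
    · exact Or.inr (by linarith)
    -- A missing atom costs at most one expected candidate, which is harmless for sparse columns.
    · have : (Measure.pi μ).real {y | A.mulVec y i₀ = τ} ≤ 1 := measureReal_le_one
      exact Or.inr (by linarith)

lemma exists_reward_of_const {n m r : ℕ} (A : Matrix (Fin n) (Fin m) ℝ≥0)
    (μ : Fin m → Measure ℝ≥0) [∀ j, IsProbabilityMeasure (μ j)]
    (hs : ∀ j, (Finset.univ.filter fun i => A i j ≠ 0).card ≤ r) (hr : 0 < r)
    (hAY : ∀ i j, Integrable (fun y : Fin m → ℝ≥0 => (A i j * y j : ℝ)) (Measure.pi μ)) {κ : ℝ}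
    (hκ : 0 ≤ κ) (hκu : κ ≤ 1 / 60) :
    ∃ alg : OnlineAlgorithm n r, ENNReal.ofReal κ * expectedOpt r A μ ≤ expectedReward alg A μ := by
  have hr' : (0 : ℝ) < r := by exact_mod_cast hr
  obtain ⟨τ, D, hE, hlow⟩ := exists_threshold (P := Measure.pi μ) (fun i y => A.mulVec y i)
    (measurable_mulVec_apply A) (r / 8) (by positivity)
  have hacc := isThreshold_thresholdRegion τ D
  simp only [← integral_hit hacc.measurableSet A] at hE hlow
  obtain ⟨I, acc', hacc', h⟩ := exists_benchmark_le hacc A μ hs hr hAY hE hlow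
  have h0 : 0 ≤ benchmark r τ A (Measure.pi μ) := add_nonneg (by positivity)
    (Finset.sum_nonneg fun i _ => integral_nonneg fun y => NNReal.coe_nonneg _)
  refine ⟨greedy r I acc' hacc', le_expectedReward_greedy (τ := τ) hacc' _ A μ hAY hκ ?_⟩
  linarith [mul_le_mul_of_nonneg_right hκu h0]

/-- The only property of the logarithmic factor that the approximation guarantee uses. -/
lemma two_fifths_le_log_rpow {r : ℕ} (hr : 2 ≤ r) : 2 / 5 ≤ Real.log r ^ (6 / 5 : ℝ) := by
  have h1 : (0.69 : ℝ) ≤ Real.log r := by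
    have h2 : Real.log 2 ≤ Real.log r := Real.log_le_log (by norm_num) (by exact_mod_cast hr)
    linarith [Real.log_two_gt_d9]
  calc (2 / 5 : ℝ) ≤ (0.69 : ℝ) ^ (2 : ℝ) := by norm_num
    _ ≤ (0.69 : ℝ) ^ (6 / 5 : ℝ) :=
      Real.rpow_le_rpow_of_exponent_ge (by norm_num) (by norm_num) (by norm_num)
    _ ≤ _ := Real.rpow_le_rpow (by norm_num) h1 (by norm_num)

theorem approxRatio_achievable (s r : ℕ) (hr : 2 ≤ r) (hsr : s ≤ r) :
    AdmitsApproximation s r (approxRatio 30000 s r) := by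
  intro n m A μ hμ hA
  by_cases hAY : ∀ i j, Integrable (fun y : Fin m → ℝ≥0 => (A i j * y j : ℝ)) (Measure.pi μ)
  swap
  · push Not at hAY
    obtain ⟨i, j, hij⟩ := hAY
    obtain ⟨alg, h⟩ := exists_expectedReward_eq_top (by omega : 0 < r) A μ i j hij
    exact ⟨alg, by rw [h]; exact le_top⟩
  rcases Nat.eq_zero_or_pos s with rfl | hs1
  -- For `s = 0` the matrix vanishes, and so does the prophet's reward; any algorithm will do.
  · refine ⟨greedy r ∅ (fun _ => Set.univ) fun _ => MeasurableSet.univ, ?_⟩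
    rw [expectedOpt_eq_zero μ hA, mul_zero]
    exact zero_le
  have hs := card_support_le_of_colSparsity_le hA
  have hr' : (0 : ℝ) < r := by exact_mod_cast (by omega : 0 < r)
  have hs' : (0 : ℝ) < s := by exact_mod_cast hs1
  set u : ℝ := ((s : ℝ) / r) ^ (1 / 5 : ℝ) with hu
  set K : ℝ := Real.log r ^ (6 / 5 : ℝ) with hK
  have hK1 : 2 / 5 ≤ K := two_fifths_le_log_rpow hr
  have hu0 : 0 < u := Real.rpow_pos_of_pos (div_pos hs' hr') _
  have hus : u ^ 5 * r = s := by
    have h := Real.rpow_inv_natCast_pow (div_pos hs' hr').le (n := 5) (by norm_num)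
    have h5 : ((5 : ℕ) : ℝ)⁻¹ = 1 / 5 := by norm_num
    rw [h5] at h
    rw [hu, h]
    field_simp
  have hα : approxRatio 30000 s r = 1 + 30000 * (u * K) := rfl
  have hα0 : 0 < approxRatio 30000 s r := by rw [hα]; positivity
  have huK : u * (2 / 5) ≤ u * K := mul_le_mul_of_nonneg_left hK1 hu0.le
  by_cases hu1 : u ≤ 1 / 100
  · refine exists_reward_of_sparse A μ hs hs1 hsr hu0 hu1 hus hAY (by positivity) ?_
    rw [div_le_iff₀ hα0, hα]
    -- The ratio is at least `1 + 12000u`, and `(1 - 29u)(1 + 12000u) ≥ 1` for `0 < u ≤ 1/100`.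
    nlinarith
  · push Not at hu1
    refine exists_reward_of_const A μ (fun j => (hs j).trans hsr) (by omega) hAY (by positivity) ?_
    -- For `u > 1/100` the ratio exceeds `1 + 30000 · (1/100) · (2/5) = 121`, more than the `60`
    -- required.
    refine one_div_le_one_div_of_le (by norm_num) ?_
    rw [hα]; linarith

/-- Powers of the logarithm are negligible against any positive power of `r`, here `r ^ (1/5)`. -/
theorem tendsto_approxRatio (C : ℝ) (s : ℕ) :
    Tendsto (fun r : ℕ => approxRatio C s r) atTop (𝓝 1) := by
  have h := ((isLittleO_log_rpow_rpow_atTop (6 / 5 : ℝ)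
    (by norm_num : (0 : ℝ) < 1 / 5)).tendsto_div_nhds_zero.comp
      (tendsto_natCast_atTop_atTop (R := ℝ))).const_mul (C * (s : ℝ) ^ (1 / 5 : ℝ))
  have h' := h.const_add 1
  rw [mul_zero, add_zero] at h'
  refine h'.congr fun r => ?_
  simp only [approxRatio, Function.comp_apply]
  rw [Real.div_rpow (Nat.cast_nonneg _) (Nat.cast_nonneg _)]
  ring

end LinProphet

end

theorem mainTheorem4 :
    ∃ C : ℝ, 0 < C ∧
      (∀ s r : ℕ, 2 ≤ r → s ≤ r →
        LinProphet.AdmitsApproximation s r (LinProphet.approxRatio C s r)) ∧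
      (∀ s : ℕ, Tendsto (fun r : ℕ => LinProphet.approxRatio C s r) atTop (𝓝 1)) :=
  ⟨30000, by norm_num, LinProphet.approxRatio_achievable,
    LinProphet.tendsto_approxRatio 30000⟩
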